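/- **Conventions.** $\lg=\log_2$. A *dealing procedure* for secrets in a set $S$ and a set of participants consists of a probability space of dealer's coins and, for each participant $i$, a finite share space and a share $Z_i^{(s)}$ depending on the secret $s$ and the coins. It is a *(perfect) $3$-threshold scheme* if (correctness) for every finite set $A$ of at least three participants some function of their shares equals $s$ with probability $1$, for every $s\in S$, and (perfect secrecy) for every set of at most two participants the joint distribution of their shares does not depend on $s$. With $n$ participants it is a $(3,n)$-threshold scheme; it is an *evolving $3$-threshold scheme* if the participants are $P_1,P_2,\dots$ and moreover each $Z_t^{(s)}$ can be drawn by a randomized algorithm from $s$ and $Z_1^{(s)},\dots,Z_{t-1}^{(s)}$. The size $B(\cdot)$ of a share is $\lg$ of the cardinality of its share space. **Generations.** Let $n_0=0$ and $n_i=2^{4^i}$ for $i\ge1$. Generation $G^i$ consists of $P_{n_{i-1}+1},\dots,P_{n_i}$, so $S(G^i)=n_i-n_{i-1}$. Let $g(t)$ be the generation of $P_t$ and $h(t)=t-n_{g(t)-1}$ its index there. **Scheme.** Let $M$ be a finite abelian group, written with $\oplus$ (for instance bit strings of a fixed length with XOR, or $\mathbb Z/p$). Let $\mathcal S^\infty$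 be an evolving $3$-threshold scheme with shares $sh^\infty_1,sh^\infty_2,\dots$, and for every $i\ge1$ let $\mathcal S^i$ be a $(3,S(G^i)+1)$-threshold scheme for the same secrets, with shares $sh^i_1,\dots,sh^i_{S(G^i)},sh^i_F$, where $sh^i_F$ is encoded injectively as an element of $M$. Deal $s$ by all these schemes with independent coins and choose independent uniform masks $SR^1,SR^2,\dots\in M$. In the *revised scheme* $P_t$ receives, with $g=g(t)$: (P1) $sh^\infty_{g}$; (P2) $sh^j_F$ for $1\le j<g$; (P3) $sh^{g}_{h(t)}$; (P4) $SR^j\oplus sh^{g}_F$ for $1\le j<g$; (P5) $SR^{g}$. **Claim.** 1. $g(t)=\lceil\log_4\lg t\rceil$ for all $t\ge 3$. 2. For every nonempty set $S$ of secrets and all $M$, $\mathcal S^\infty$, $\mathcal S^i$ as above, the revised scheme is a perfect evolving $3$-threshold scheme: any three participants recover $s$, and any two (or fewer) learn nothing about $s$. The $t$-th share has size $$B(sh^\infty_{g(t)})+B(sh^{g(t)}_{h(t)})+(2g(t)-1)\lg|M| .$$ 3. For every $\ell\ge1$ there is a constant $C$ such that for every prime $p\ge 2^\ell$ and every finite abelian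 group $M$ with $p\le|M|<2p$ (for instance $\mathbb Z/p$, or the strings of $\lceil\lg p\rceil$ bits with XOR) there are, for $\ell$-bit secrets, $\mathcal S^\infty$ and $\mathcal S^i$ as above for which the revised scheme, a perfect evolving $3$-threshold scheme, has for all $t\ge3$ a $t$-th share of $$\lg t+O\big(\lceil\log_4\lg t\rceil^2\big)+\lg p\,\big(2\lceil\log_4\lg t\rceil-1\big)$$ bits, where the absolute value of the $O$-term is at most $C\lceil\log_4\lg t\rceil^2$. -/

import Mathlib

open MeasureTheory

/-- A dealing procedure for secrets in `S` and participants indexed by `ι`: the dealer draws coins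
`ω` from a probability space and hands `share i s ω`, an element of the finite set `Share i`, to
participant `i`. -/
structure DealScheme (S : Type*) (ι : Type) where
  Coins : Type
  [coinsMeasurable : MeasurableSpace Coins]
  law : Measure Coins
  [lawProb : IsProbabilityMeasure law]
  Share : ι → Type
  [shareFinite : ∀ i, Finite (Share i)]
  share : ∀ i, S → Coins → Share i
  measurable_share : ∀ i s (z : Share i), MeasurableSet {ω | share i s ω = z}

attribute [instance] DealScheme.coinsMeasurable DealScheme.lawProb DealScheme.shareFinite

namespace DealScheme

variable {S : Type*} {ι : Type}

/-- Perfect correctness for threshold `k`: every finite set of at least `k` participants has a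
reconstruction function that returns the secret with probability one. -/
def Correct (Z : DealScheme S ι) (k : ℕ) : Prop :=
  ∀ A : Finset ι, k ≤ A.card →
    ∃ R : (∀ i : A, Z.Share i) → S, ∀ s, ∀ᵐ ω ∂Z.law, R (fun i => Z.share i s ω) = s

/-- Perfect secrecy for threshold `k`: the joint distribution of the shares of fewer than `k`
participants does not depend on the secret. -/
def Secret (Z : DealScheme S ι) (k : ℕ) : Prop :=
  ∀ C : Finset ι, C.card < k → ∀ (s₀ s₁ : S) (z : ∀ i, Z.Share i),
    Z.law {ω | ∀ i ∈ C, Z.share i s₀ ω = z i} = Z.law {ω | ∀ i ∈ C, Z.share i s₁ ω = z i}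

/-- A perfect `k`-threshold scheme; with `n` participants, a `(k, n)`-threshold scheme. -/
def IsThreshold (Z : DealScheme S ι) (k : ℕ) : Prop :=
  Z.Correct k ∧ Z.Secret k

/-- The `t`-th share can be drawn by a randomized algorithm `E` from the secret and the shares of
the participants before `t`. -/
def Composes (Z : DealScheme S ℕ+) : Prop :=
  ∃ E : ∀ t : ℕ+, S → (∀ i : Set.Iio t, Z.Share i) → PMF (Z.Share t),
    ∀ (s : S) (t : ℕ+) (z : ∀ i, Z.Share i),
      Z.law {ω | ∀ i ≤ t, Z.share i s ω = z i} =
        Z.law {ω | ∀ i < t, Z.share i s ω = z i} * E t s (fun i => z i) (z t)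

/-- A perfect evolving `k`-threshold scheme for the participants `1, 2, 3, …`. -/
def IsEvolvingThreshold (Z : DealScheme S ℕ+) (k : ℕ) : Prop :=
  Z.Composes ∧ Z.IsThreshold k

/-- The size of the share of participant `i` in bits. -/
noncomputable def bits (Z : DealScheme S ι) (i : ι) : ℝ :=
  Real.logb 2 (Nat.card (Z.Share i))

end DealScheme

/-- The last participant of generation `i`: `n₀ = 0` and `nᵢ = 2 ^ (4 ^ i)` for `i ≥ 1`. -/
def genEnd (i : ℕ) : ℕ := if i = 0 then 0 else 2 ^ 4 ^ i

/-- The number of participants of generation `i`, which consists of the participants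
`nᵢ₋₁ + 1, …, nᵢ`. -/
def genSize (i : ℕ+) : ℕ := genEnd i - genEnd ((i : ℕ) - 1)

theorem exists_le_genEnd (t : ℕ+) : ∃ i : ℕ+, (t : ℕ) ≤ genEnd i := by
  refine ⟨t, ?_⟩
  have h1 : (t : ℕ) < 4 ^ (t : ℕ) := Nat.lt_pow_self (by norm_num)
  have h2 : 4 ^ (t : ℕ) < 2 ^ 4 ^ (t : ℕ) := Nat.lt_pow_self (by norm_num)
  simp only [genEnd, t.ne_zero, if_false]
  omega

/-- The generation `g(t)` of participant `t`. -/
def gen (t : ℕ+) : ℕ+ := PNat.find (exists_le_genEnd t)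

theorem le_genEnd_gen (t : ℕ+) : (t : ℕ) ≤ genEnd (gen t) := PNat.find_spec (exists_le_genEnd t)

theorem genEnd_pred_gen_lt (t : ℕ+) : genEnd ((gen t : ℕ) - 1) < t := by
  by_cases h : (gen t : ℕ) = 1
  · simp [h, genEnd]
  · have h1 : 0 < (gen t : ℕ) := (gen t).pos
    have h2 : (⟨(gen t : ℕ) - 1, by omega⟩ : ℕ+) < gen t := by
      apply PNat.coe_lt_coe _ _ |>.1
      simp only [PNat.mk_coe]
      omega
    have h3 := PNat.find_min (exists_le_genEnd t) h2
    simpa using h3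

/-- The (zero-based) index of participant `t` inside its generation. -/
def genIndex (t : ℕ+) : Fin (genSize (gen t)) :=
  ⟨(t : ℕ) - genEnd ((gen t : ℕ) - 1) - 1, by
    have h1 := le_genEnd_gen t
    have h2 := genEnd_pred_gen_lt t
    unfold genSize
    omega⟩

/-- The revised scheme. `Sinf` deals shares to the generations; `SG i` deals one share
`some h` to each member of generation `i` and one forward share `none`, which `e i` encodes as an
element of a finite abelian group `M` common to all generations (the `⊕` of bit strings is the
addition of `M` if `M` consists of bit strings). All component schemes and the uniform masks
`SR i : M` use independent coins. The five components of the share of participant `t` are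
the share of its generation under `Sinf`, the forward shares of all earlier generations,
its own share inside its generation, the forward share of its generation masked with `SR j`
for all earlier `j`, and the mask of its own generation. -/
noncomputable def revisedScheme {S : Type*} {M : Type} [AddCommGroup M] [Finite M]
    [MeasurableSpace M] [DiscreteMeasurableSpace M]
    (Sinf : DealScheme S ℕ+) (SG : ∀ i : ℕ+, DealScheme S (Option (Fin (genSize i))))
    (e : ∀ i, (SG i).Share none ↪ M) : DealScheme S ℕ+ where
  Coins := Sinf.Coins × (∀ i, (SG i).Coins) × (ℕ+ → M)
  law :=
    haveI : IsProbabilityMeasure (ProbabilityTheory.uniformOn (Set.univ : Set M)) :=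
      ProbabilityTheory.isProbabilityMeasure_uniformOn Set.finite_univ Set.univ_nonempty
    Sinf.law.prod ((Measure.infinitePi fun i => (SG i).law).prod
      (Measure.infinitePi fun _ : ℕ+ => ProbabilityTheory.uniformOn (Set.univ : Set M)))
  lawProb :=
    haveI : IsProbabilityMeasure (ProbabilityTheory.uniformOn (Set.univ : Set M)) :=
      ProbabilityTheory.isProbabilityMeasure_uniformOn Set.finite_univ Set.univ_nonempty
    inferInstance
  Share t := Sinf.Share (gen t) × (Set.Iio (gen t) → M) ×
    (SG (gen t)).Share (some (genIndex t)) × (Set.Iio (gen t) → M) × M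
  share t s ω :=
    (Sinf.share (gen t) s ω.1,
      fun j => e j ((SG j).share none s (ω.2.1 j)),
      (SG (gen t)).share (some (genIndex t)) s (ω.2.1 (gen t)),
      fun j => ω.2.2 j + e (gen t) ((SG (gen t)).share none s (ω.2.1 (gen t))),
      ω.2.2 (gen t))
  measurable_share t s z := by
    let (i : ℕ+) : MeasurableSpace (Sinf.Share i) := ⊤
    let (i : ℕ+) (o) : MeasurableSpace ((SG i).Share o) := ⊤
    have h1 (i : ℕ+) : Measurable (Sinf.share i s) :=
      measurable_to_countable' fun z => Sinf.measurable_share i s z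
    have h2 (i : ℕ+) (o) : Measurable ((SG i).share o s) :=
      measurable_to_countable' fun z => (SG i).measurable_share o s z
    have h3 (i : ℕ+) : Measurable (e i) := measurable_from_top
    have h4 (i : ℕ+) : Measurable fun ω : Sinf.Coins × (∀ i, (SG i).Coins) × (ℕ+ → M) =>
        ω.2.1 i := (measurable_pi_apply i).comp (measurable_fst.comp measurable_snd)
    have h5 (i : ℕ+) : Measurable fun ω : Sinf.Coins × (∀ i, (SG i).Coins) × (ℕ+ → M) =>
        ω.2.2 i := (measurable_pi_apply i).comp (measurable_snd.comp measurable_snd)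
    have h6 : Measurable fun q : M × M => q.1 + q.2 := measurable_of_countable _
    have h7 (j : ℕ+) : Measurable fun ω : Sinf.Coins × (∀ i, (SG i).Coins) × (ℕ+ → M) =>
        e j ((SG j).share none s (ω.2.1 j)) := (h3 j).comp ((h2 _ _).comp (h4 _))
    have h8 : Measurable fun ω : Sinf.Coins × (∀ i, (SG i).Coins) × (ℕ+ → M) =>
        (Sinf.share (gen t) s ω.1,
          (fun j : Set.Iio (gen t) => e j ((SG j).share none s (ω.2.1 j))),
          (SG (gen t)).share (some (genIndex t)) s (ω.2.1 (gen t)),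
          (fun j : Set.Iio (gen t) =>
            ω.2.2 j + e (gen t) ((SG (gen t)).share none s (ω.2.1 (gen t)))),
          ω.2.2 (gen t)) :=
      ((h1 _).comp measurable_fst).prodMk
        ((measurable_pi_lambda _ fun j : Set.Iio (gen t) => h7 j).prodMk
          (((h2 (gen t) (some (genIndex t))).comp (h4 _)).prodMk
            ((measurable_pi_lambda _ fun j : Set.Iio (gen t) =>
              h6.comp ((h5 j).prodMk (h7 (gen t)))).prodMk (h5 (gen t)))))
    exact h8 (measurableSet_singleton z)

/-! ### General tools: reconstruction, sequential sampling, secrecy -/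

namespace DealScheme

variable {S : Type*} {ι : Type}

/-! Reconstruction. Three participants of three different generations use the evolving scheme.
Otherwise two of them lie in one generation `g`. The third is in `g` as well, or it is later and
holds the forward share of `g` in the clear, or it belongs to an earlier generation `j` and holds
the mask `SR j` that uncovers the forward share of `g`. In each case three shares of one component
scheme are known (`revisedScheme_correct`).

Secrecy. Two participants of different generations see at most the forward share and one member
share of each generation scheme. Two participants of one generation `g` see two member shares of its
scheme, but its forward share only under masks `SR j`, `j < g`, which they do not hold; a
translation of these masks replaces that forward share with a constant. Either way at most two
shares of each of the independent component schemes matter (`revisedScheme_secret`). Sequential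
dealing is automatic by conditioning (`composes`).

Short shares. The evolving scheme may cost `O(g ^ 2)` bits (`tripleScheme`), but generation `i`
needs `lg t + O(i)` bits per member and a forward share no longer than the secret
(`twoLevelScheme`). Let `K` be a field of odd prime order depending only on `ℓ`, and take a
quadratic polynomial over an extension of `K` with leading coefficient `c₂` in `K` and linear
coefficient `c₁`. Its values at `x` and `y` yield the slope `c₁ + c₂ (x + y)`. All points satisfy `φ
= μ` and `ψ = 0`, so the slope yields `φ c₁ + 2 μ c₂` and `ψ c₁`. As every share contains `φ c₁ - s`
and `ψ c₁ - u`, a pair learns `u` and `s + 2 μ c₂`, and a third point gives `c₂`. With `u = s + r`,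
where `r` is the forward share, a pair and the forward share recover the secret.

To have shares of length about `lg t`, members are grouped into levels by the integer part of `lg
t`, each level with its own field; one more polynomial with the same `c₂` treats levels as
participants. It has `μ = 2`, the levels have `μ = 1`: a pair inside a level learns `s + 2 c₂`, a
pair across levels `s + 4 c₂`, and both together give `s`. -/

theorem nonempty_coins (Z : DealScheme S ι) : Nonempty Z.Coins :=
  nonempty_of_isProbabilityMeasure Z.law

theorem nonempty_share [Nonempty S] (Z : DealScheme S ι) (i : ι) : Nonempty (Z.Share i) :=
  ⟨Z.share i (Classical.arbitrary S) Z.nonempty_coins.some⟩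

theorem measurableSet_forall_share_eq (Z : DealScheme S ι) (s : S) {p : ι → Prop}
    (hp : {i | p i}.Countable) (z : ∀ i, Z.Share i) :
    MeasurableSet {ω | ∀ i, p i → Z.share i s ω = z i} := by
  have : {ω | ∀ i, p i → Z.share i s ω = z i} =
      ⋂ i ∈ {i | p i}, {ω | Z.share i s ω = z i} := by
    ext ω; simp
  rw [this]
  exact MeasurableSet.biInter hp fun i _ => Z.measurable_share i s (z i)

/-- A group of participants can reconstruct the secret if, away from null events, its shares
determine the secret. -/
theorem correct_iff [Nonempty S] (Z : DealScheme S ι) (k : ℕ) :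
    Z.Correct k ↔ ∀ A : Finset ι, k ≤ A.card → ∃ good : S → Set Z.Coins,
      (∀ s, ∀ᵐ ω ∂Z.law, ω ∈ good s) ∧
      ∀ s s' ω ω', ω ∈ good s → ω' ∈ good s' →
        (∀ i ∈ A, Z.share i s ω = Z.share i s' ω') → s = s' := by
  classical
  refine forall₂_congr fun A _ => ⟨?_, ?_⟩
  · rintro ⟨R, hR⟩
    refine ⟨fun s => {ω | R (fun i => Z.share i s ω) = s}, hR, ?_⟩
    intro s s' ω ω' h h' he
    rw [← show R (fun i => Z.share i s ω) = s from h,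
      ← show R (fun i => Z.share i s' ω') = s' from h']
    congr 1
    funext i
    exact he i i.2
  · rintro ⟨good, h1, h2⟩
    let P : (∀ i : A, Z.Share i) → S → Prop := fun v s =>
      ∃ ω ∈ good s, ∀ i : A, Z.share i s ω = v i
    refine ⟨fun v => if h : ∃ s, P v s then h.choose else Classical.arbitrary S, fun s => ?_⟩
    filter_upwards [h1 s] with ω hω
    have h : ∃ s', P (fun i => Z.share i s ω) s' := ⟨s, ω, hω, fun _ => rfl⟩
    rw [dif_pos h]
    obtain ⟨ω', hω', he⟩ := h.choose_spec
    exact h2 _ _ ω' ω hω' hω fun i hi => he ⟨i, hi⟩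

/-- Shares that take finitely many values can always be drawn one after the other from their
conditional distributions. -/
theorem composes (Z : DealScheme S ℕ+) : Z.Composes := by
  classical
  let Ev (t : ℕ+) (s : S) (z : ∀ i : Set.Iio t, Z.Share i) : Set Z.Coins :=
    {ω | ∀ i : Set.Iio t, Z.share i s ω = z i}
  let (t : ℕ+) : MeasurableSpace (Z.Share t) := ⊤
  have hm (t : ℕ+) (s : S) : Measurable (Z.share t s) :=
    measurable_to_countable' fun z => Z.measurable_share t s z
  have hEv (t : ℕ+) (s : S) (z) : MeasurableSet (Ev t s z) := by
    have : Ev t s z = ⋂ i : Set.Iio t, {ω | Z.share i s ω = z i} := by ext; simp [Ev]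
    rw [this]
    exact MeasurableSet.iInter fun i => Z.measurable_share i s _
  have key (t : ℕ+) (s : S) (z : ∀ i : Set.Iio t, Z.Share i) : ∃ q : PMF (Z.Share t),
      ∀ a, Z.law (Ev t s z ∩ {ω | Z.share t s ω = a}) = Z.law (Ev t s z) * q a := by
    by_cases h0 : Z.law (Ev t s z) = 0
    -- Conditioning on a null event: both sides vanish, so any distribution serves.
    · refine ⟨PMF.pure (Z.share t s Z.nonempty_coins.some), fun a => ?_⟩
      rw [h0, zero_mul]
      exact measure_mono_null Set.inter_subset_left h0
    · have := ProbabilityTheory.cond_isProbabilityMeasure h0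
      have : IsProbabilityMeasure ((ProbabilityTheory.cond Z.law (Ev t s z)).map
        (Z.share t s)) := Measure.isProbabilityMeasure_map (hm t s).aemeasurable
      refine ⟨((ProbabilityTheory.cond Z.law (Ev t s z)).map (Z.share t s)).toPMF, fun a => ?_⟩
      rw [Measure.toPMF_apply, Measure.map_apply (hm t s) (measurableSet_singleton a), mul_comm,
        ← ProbabilityTheory.cond_mul_eq_inter (hEv t s z)]
      rfl
  choose E hE using key
  refine ⟨fun t s z => E t s z, fun s t z => ?_⟩
  rw [show {ω | ∀ i < t, Z.share i s ω = z i} = Ev t s (fun i => z i) by ext; simp [Ev],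
    ← hE]
  congr 1
  ext ω
  simp only [Ev, Set.mem_ofPred_eq, Set.mem_inter_iff, Subtype.forall, Set.mem_Iio]
  constructor
  · exact fun h => ⟨fun i hi => h i hi.le, h t le_rfl⟩
  · rintro ⟨h, h'⟩ i hi
    rcases hi.lt_or_eq with hi | rfl
    · exact h i hi
    · exact h'

/-- Secrecy follows if the coins for one secret can be transformed into coins for another secret
without changing the law of the coins and the observed shares. -/
theorem secret_of_measurePreserving (Z : DealScheme S ι) (k : ℕ)
    (h : ∀ C : Finset ι, C.card < k → ∀ s₀ s₁ : S, ∃ Φ : Z.Coins → Z.Coins,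
      MeasurePreserving Φ Z.law Z.law ∧ ∀ ω, ∀ i ∈ C, Z.share i s₁ (Φ ω) = Z.share i s₀ ω) :
    Z.Secret k := by
  intro C hC s₀ s₁ z
  obtain ⟨Φ, hΦ, he⟩ := h C hC s₀ s₁
  rw [← hΦ.measure_preimage
    (Z.measurableSet_forall_share_eq s₁ (p := (· ∈ C)) C.countable_toSet z).nullMeasurableSet]
  congr 1
  ext ω
  exact forall₂_congr fun i hi => by rw [he ω i hi]

/-- The vector of all shares, in which the shares outside of `D` are replaced with `d`. -/
noncomputable def observe (Z : DealScheme S ι) (D : Set ι) (d : ∀ i, Z.Share i) (s : S)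
    (ω : Z.Coins) (i : ι) : Z.Share i :=
  open scoped Classical in if i ∈ D then Z.share i s ω else d i

theorem observe_of_mem (Z : DealScheme S ι) {D : Set ι} (d : ∀ i, Z.Share i) (s : S)
    (ω : Z.Coins) {i : ι} (hi : i ∈ D) : Z.observe D d s ω i = Z.share i s ω := if_pos hi

/-- The discrete σ-algebra on a share space. -/
abbrev shareSpace (Z : DealScheme S ι) (i : ι) : MeasurableSpace (Z.Share i) := ⊤

attribute [local instance] shareSpace

theorem measurable_share' (Z : DealScheme S ι) (i : ι) (s : S) : Measurable (Z.share i s) :=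
  measurable_to_countable' fun z => Z.measurable_share i s z

theorem measurable_observe (Z : DealScheme S ι) (D : Set ι) (d : ∀ i, Z.Share i) (s : S) :
    Measurable (Z.observe D d s) := by
  refine measurable_pi_lambda _ fun i => ?_
  unfold observe
  split_ifs
  · exact Z.measurable_share' i s
  · exact measurable_const

/-- Secrecy speaks of single outcomes. Share spaces are finite, so it upgrades to an equality of
laws, which can then be combined by product measures. The fixed default `d` keeps the type of the
view independent of `C`. -/
theorem Secret.map_observe_eq {Z : DealScheme S ι} {k : ℕ} (hZ : Z.Secret k) (C : Finset ι)
    (hC : C.card < k) (d : ∀ i, Z.Share i) (s₀ s₁ : S) :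
    Z.law.map (Z.observe C d s₀) = Z.law.map (Z.observe C d s₁) := by
  classical
  let ext : (∀ i : C, Z.Share i) → ∀ i, Z.Share i := fun v i => if h : i ∈ C then v ⟨i, h⟩ else d i
  let view : S → Z.Coins → ∀ i : C, Z.Share i := fun s ω i => Z.share i s ω
  have hview (s) : Measurable (view s) := measurable_pi_lambda _ fun i => Z.measurable_share' i s
  have hext : Measurable ext := measurable_of_countable _
  have hobs (s) : Z.observe C d s = ext ∘ view s := by
    funext ω i
    simp only [observe, ext, view, Function.comp, Finset.mem_coe, dite_eq_ite]
  rw [hobs, hobs, ← Measure.map_map hext (hview _), ← Measure.map_map hext (hview _)]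
  congr 1
  refine Measure.ext_of_singleton fun v => ?_
  rw [Measure.map_apply (hview _) (measurableSet_singleton v),
    Measure.map_apply (hview _) (measurableSet_singleton v)]
  have h := hZ C hC s₀ s₁ (ext v)
  have hset (s) : view s ⁻¹' {v} = {ω | ∀ i ∈ C, Z.share i s ω = ext v i} := by
    ext ω
    simp only [view, Set.mem_preimage, Set.mem_singleton_iff, funext_iff, Subtype.forall,
      Set.mem_ofPred_eq, ext]
    exact forall₂_congr fun i hi => by rw [dif_pos hi]
  rw [hset, hset, h]

end DealScheme

/-! ### Arithmetic of the generations -/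

theorem gen_eq_iff {t : ℕ+} {i : ℕ+} :
    gen t = i ↔ genEnd ((i : ℕ) - 1) < t ∧ (t : ℕ) ≤ genEnd i := by
  have hmono : Monotone genEnd := by
    intro a b hab
    unfold genEnd
    split_ifs with h1 h2
    · exact le_rfl
    · exact Nat.zero_le _
    · omega
    · exact Nat.pow_le_pow_right (by norm_num) (Nat.pow_le_pow_right (by norm_num) hab)
  constructor
  · rintro rfl
    exact ⟨genEnd_pred_gen_lt t, le_genEnd_gen t⟩
  · rintro ⟨h1, h2⟩
    have h3 := genEnd_pred_gen_lt t
    have h4 := le_genEnd_gen t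
    by_contra hne
    have hne' : (gen t : ℕ) ≠ i := fun h => hne (PNat.coe_injective h)
    rcases Nat.lt_or_gt_of_ne hne' with h | h
    · have := hmono (show (gen t : ℕ) ≤ (i : ℕ) - 1 by omega)
      omega
    · have := hmono (show (i : ℕ) ≤ (gen t : ℕ) - 1 by omega)
      omega

theorem gen_eq_ceil (t : ℕ+) (ht : 3 ≤ t) :
    ((gen t : ℕ) : ℤ) = ⌈Real.logb 4 (Real.logb 2 (t : ℕ))⌉ := by
  have ht3 : (3 : ℝ) ≤ ((t : ℕ) : ℝ) := by exact_mod_cast ht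
  have hlog : 1 < Real.logb 2 ((t : ℕ) : ℝ) := by
    rw [Real.lt_logb_iff_rpow_lt (by norm_num) (by linarith)]
    rw [Real.rpow_one]
    linarith
  have hend (i : ℕ) (hi : i ≠ 0) : Real.logb 4 (Real.logb 2 ((genEnd i : ℕ) : ℝ)) = i := by
    simp only [genEnd, hi, if_false]
    push_cast
    rw [← Real.rpow_natCast, Real.logb_rpow (by norm_num) (by norm_num)]
    push_cast
    rw [← Real.rpow_natCast, Real.logb_rpow (by norm_num) (by norm_num)]
  have hg := (gen t).pos
  symm
  rw [Int.ceil_eq_iff]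
  push_cast
  constructor
  -- The first generation starts after `genEnd 0 = 0`, which is not of the form `2 ^ 4 ^ i`; there
  -- the lower bound comes from `lg t > 1`, that is, from `t ≥ 3`.
  · by_cases h1 : (gen t : ℕ) = 1
    · rw [h1]
      norm_num
      exact Real.logb_pos (by norm_num) hlog
    · have h := genEnd_pred_gen_lt t
      have hpos : (1 : ℝ) < (genEnd ((gen t : ℕ) - 1) : ℕ) := by
        have h0 : (gen t : ℕ) - 1 ≠ 0 := by omega
        simp only [genEnd, h0, if_false]
        exact_mod_cast Nat.one_lt_two_pow (by positivity)
      have h2 : Real.logb 4 (Real.logb 2 ((genEnd ((gen t : ℕ) - 1) : ℕ) : ℝ)) <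
          Real.logb 4 (Real.logb 2 ((t : ℕ) : ℝ)) := by
        apply Real.logb_lt_logb (by norm_num) (Real.logb_pos (by norm_num) hpos)
        exact Real.logb_lt_logb (by norm_num) (by linarith) (by exact_mod_cast h)
      rw [hend _ (by omega)] at h2
      rw [Nat.cast_sub (by omega)] at h2
      simpa using h2
  · have h := le_genEnd_gen t
    rw [← hend (gen t) (by omega)]
    apply Real.logb_le_logb_of_le (by norm_num) (by linarith)
    exact Real.logb_le_logb_of_le (by norm_num) (by linarith) (by exact_mod_cast h)

/-! ### Invariance of uniform masks -/

theorem isProbabilityMeasure_uniformOn_univ {α : Type*} [Finite α] [Nonempty α]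
    [MeasurableSpace α] [DiscreteMeasurableSpace α] :
    IsProbabilityMeasure (ProbabilityTheory.uniformOn (Set.univ : Set α)) :=
  ProbabilityTheory.isProbabilityMeasure_uniformOn Set.finite_univ Set.univ_nonempty

attribute [local instance] isProbabilityMeasure_uniformOn_univ

theorem measurePreserving_uniformOn_univ {α : Type*} [Finite α] [MeasurableSpace α]
    [DiscreteMeasurableSpace α] {f : α → α} (hf : f.Injective) :
    MeasurePreserving f (ProbabilityTheory.uniformOn (Set.univ : Set α))
      (ProbabilityTheory.uniformOn (Set.univ : Set α)) := by
  have := Fintype.ofFinite α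
  refine ⟨measurable_of_countable f, Measure.ext_of_singleton fun a => ?_⟩
  obtain ⟨b, rfl⟩ := (Finite.injective_iff_surjective.1 hf) a
  have hb : f ⁻¹' {f b} = {b} := by ext c; simp [hf.eq_iff]
  rw [Measure.map_apply (measurable_of_countable f) (measurableSet_singleton _), hb,
    ProbabilityTheory.uniformOn_univ, ProbabilityTheory.uniformOn_univ, Measure.count_singleton,
    Measure.count_singleton]

/-- Independent uniform elements of a finite group remain so after a translation. -/
theorem measurePreserving_add_infinitePi_uniformOn {κ G : Type*} [AddCommGroup G] [Finite G]
    [MeasurableSpace G] [DiscreteMeasurableSpace G] (v : κ → G) :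
    MeasurePreserving (fun m : κ → G => m + v)
      (Measure.infinitePi fun _ : κ => ProbabilityTheory.uniformOn (Set.univ : Set G))
      (Measure.infinitePi fun _ : κ => ProbabilityTheory.uniformOn (Set.univ : Set G)) := by
  have h (i : κ) := measurePreserving_uniformOn_univ (add_left_injective (v i))
  refine ⟨measurable_pi_lambda _ fun i => (h i).measurable.comp (measurable_pi_apply i), ?_⟩
  calc _ = Measure.infinitePi fun i : κ =>
        (ProbabilityTheory.uniformOn (Set.univ : Set G)).map (· + v i) :=
        Measure.infinitePi_map_pi _ fun i => (h i).measurable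
    _ = _ := by simp only [(h _).map_eq]

/-- The index of participant `t` inside generation `g`. -/
def genMember (g t : ℕ+) (h : gen t = g) : Fin (genSize g) := h ▸ genIndex t

theorem genMember_val (g t : ℕ+) (h : gen t = g) :
    (genMember g t h : ℕ) = t - genEnd ((g : ℕ) - 1) - 1 := by
  subst h; rfl

theorem genMember_injective {g t u : ℕ+} (ht : gen t = g) (hu : gen u = g)
    (h : genMember g t ht = genMember g u hu) : t = u := by
  have h1 := congrArg Fin.val h
  rw [genMember_val, genMember_val] at h1
  have h2 := (gen_eq_iff.1 ht).1
  have h3 := (gen_eq_iff.1 hu).1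
  exact PNat.coe_injective (by omega)

/-! ### The revised scheme: correctness, secrecy, share size -/

namespace DealScheme

attribute [local instance] shareSpace

section Revised

variable {S : Type*} {M : Type} [AddCommGroup M] [Finite M]
    [MeasurableSpace M] [DiscreteMeasurableSpace M]
    (Sinf : DealScheme S ℕ+) (SG : ∀ i : ℕ+, DealScheme S (Option (Fin (genSize i))))
    (e : ∀ i, (SG i).Share none ↪ M)

variable {Sinf SG e} in
theorem revisedScheme_share_eq {t g : ℕ+} (hg : gen t = g) {s s' : S}
    {ω ω' : (revisedScheme Sinf SG e).Coins}
    (h : (revisedScheme Sinf SG e).share t s ω = (revisedScheme Sinf SG e).share t s' ω') :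
    Sinf.share g s ω.1 = Sinf.share g s' ω'.1 ∧
    (∀ j < g, (SG j).share none s (ω.2.1 j) = (SG j).share none s' (ω'.2.1 j)) ∧
    (SG g).share (some (genMember g t hg)) s (ω.2.1 g) =
      (SG g).share (some (genMember g t hg)) s' (ω'.2.1 g) ∧
    (∀ j < g, ω.2.2 j + e g ((SG g).share none s (ω.2.1 g)) =
      ω'.2.2 j + e g ((SG g).share none s' (ω'.2.1 g))) ∧
    ω.2.2 g = ω'.2.2 g := by
  subst hg
  simp only [revisedScheme, Prod.mk.injEq] at h
  obtain ⟨h1, h2, h3, h4, h5⟩ := h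
  exact ⟨h1, fun j hj => (e j).injective (congrFun h2 ⟨j, hj⟩), h3,
    fun j hj => congrFun h4 ⟨j, hj⟩, h5⟩

theorem ae_generation {g : ℕ+} {P : (SG g).Coins → Prop} (h : ∀ᵐ ω ∂(SG g).law, P ω) :
    ∀ᵐ ω ∂(revisedScheme Sinf SG e).law, P (ω.2.1 g) :=
  (((measurePreserving_eval_infinitePi (fun i => (SG i).law) g).quasiMeasurePreserving.comp
    Measure.quasiMeasurePreserving_fst).comp Measure.quasiMeasurePreserving_snd).ae h

/-- By `correct_iff` it suffices that the shares of `A` determine three shares of one component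
scheme, whose own reconstruction then applies almost surely. -/
theorem revisedScheme_correct [Nonempty S] (hinf : Sinf.Correct 3)
    (hG : ∀ i, (SG i).Correct 3) : (revisedScheme Sinf SG e).Correct 3 := by
  classical
  rw [correct_iff] at hinf ⊢
  intro A hA
  have inside (g : ℕ+) (D : Finset (Option (Fin (genSize g)))) (hD : 3 ≤ D.card)
      (h : ∀ s s' (ω ω' : (revisedScheme Sinf SG e).Coins),
        (∀ t ∈ A, (revisedScheme Sinf SG e).share t s ω =
          (revisedScheme Sinf SG e).share t s' ω') →
        ∀ o ∈ D, (SG g).share o s (ω.2.1 g) = (SG g).share o s' (ω'.2.1 g)) :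
      ∃ good : S → Set (revisedScheme Sinf SG e).Coins,
        (∀ s, ∀ᵐ ω ∂(revisedScheme Sinf SG e).law, ω ∈ good s) ∧
        ∀ s s' ω ω', ω ∈ good s → ω' ∈ good s' →
          (∀ i ∈ A, (revisedScheme Sinf SG e).share i s ω =
            (revisedScheme Sinf SG e).share i s' ω') → s = s' := by
    obtain ⟨good, h1, h2⟩ := ((SG g).correct_iff 3).1 (hG g) D hD
    exact ⟨fun s => {ω | ω.2.1 g ∈ good s}, fun s => ae_generation Sinf SG e (h1 s),
      fun s s' ω ω' hω hω' he => h2 s s' _ _ hω hω' (h s s' ω ω' he)⟩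
  by_cases hc : 3 ≤ (A.image gen).card
  · obtain ⟨good, h1, h2⟩ := hinf _ hc
    refine ⟨fun s => {ω | ω.1 ∈ good s},
      fun s => Measure.quasiMeasurePreserving_fst.ae (h1 s), fun s s' ω ω' hω hω' he => ?_⟩
    refine h2 s s' _ _ hω hω' fun g hg => ?_
    obtain ⟨t, ht, rfl⟩ := Finset.mem_image.1 hg
    exact (revisedScheme_share_eq rfl (he t ht)).1
  · obtain ⟨t, ht, u, hu, htu, hgen⟩ := Finset.exists_ne_map_eq_of_card_lt_of_maps_to
      (show (A.image gen).card < A.card by omega) (fun t ht => Finset.mem_image_of_mem gen ht)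
    obtain ⟨v, hv, hvt, hvu⟩ : ∃ v ∈ A, v ≠ t ∧ v ≠ u := by
      by_contra! h
      have : A ⊆ {t, u} := fun v hv => by
        by_cases hvt : v = t
        · simp [hvt]
        · simp [h v hv hvt]
      have := (Finset.card_le_card this).trans Finset.card_le_two
      omega
    obtain ⟨g, hg⟩ : ∃ g, gen t = g := ⟨_, rfl⟩
    have hg' : gen u = g := hgen ▸ hg
    have hne {a b : ℕ+} (ha : gen a = g) (hb : gen b = g) (hab : a ≠ b) :
        some (genMember g a ha) ≠ some (genMember g b hb) :=
      fun h => hab (genMember_injective ha hb (Option.some_injective _ h))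
    by_cases hvg : gen v = g
    · refine inside g {some (genMember g t hg), some (genMember g u hg'),
        some (genMember g v hvg)} ?_ fun s s' ω ω' he o ho => ?_
      · rw [Finset.card_eq_three.2 ⟨_, _, _, hne hg hg' htu, hne hg hvg hvt.symm,
          hne hg' hvg hvu.symm, rfl⟩]
      · simp only [Finset.mem_insert, Finset.mem_singleton] at ho
        rcases ho with rfl | rfl | rfl
        · exact (revisedScheme_share_eq hg (he t ht)).2.2.1
        · exact (revisedScheme_share_eq hg' (he u hu)).2.2.1
        · exact (revisedScheme_share_eq hvg (he v hv)).2.2.1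
    · refine inside g {some (genMember g t hg), some (genMember g u hg'), none} ?_
        fun s s' ω ω' he o ho => ?_
      · rw [Finset.card_eq_three.2 ⟨_, _, _, hne hg hg' htu, Option.some_ne_none _,
          Option.some_ne_none _, rfl⟩]
      · simp only [Finset.mem_insert, Finset.mem_singleton] at ho
        have h1 := revisedScheme_share_eq hg (he t ht)
        rcases ho with rfl | rfl | rfl
        · exact h1.2.2.1
        · exact (revisedScheme_share_eq hg' (he u hu)).2.2.1
        · have h2 := revisedScheme_share_eq rfl (he v hv)
          -- An earlier `v` holds the mask under which `t` holds the forward share of `g`; a later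
          -- `v` holds that forward share itself.
          rcases lt_or_gt_of_ne hvg with hlt | hlt
          · have h3 := h1.2.2.2.1 _ hlt
            rw [h2.2.2.2.2] at h3
            exact (e g).injective (add_left_cancel h3)
          · exact h2.2.1 g hlt

/-- The share of participant `t` in the revised scheme as a function of the shares of the
component schemes and of the masks. -/
def assemble
    (w : (∀ i, Sinf.Share i) × (∀ i, ∀ o, (SG i).Share o) × (ℕ+ → M)) (t : ℕ+) :
    (revisedScheme Sinf SG e).Share t :=
  (w.1 (gen t), fun j => e j (w.2.1 j none), w.2.1 (gen t) (some (genIndex t)),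
    fun j => w.2.2 j + e (gen t) (w.2.1 (gen t) none), w.2.2 (gen t))

theorem measurableSet_assemble_eq (t : ℕ+) (z : (revisedScheme Sinf SG e).Share t) :
    MeasurableSet {w | assemble Sinf SG e w t = z} := by
  have h1 (j : ℕ+) (o) : Measurable
      fun w : (∀ i, Sinf.Share i) × (∀ i, ∀ o, (SG i).Share o) × (ℕ+ → M) => w.2.1 j o :=
    (measurable_pi_apply o).comp
      ((measurable_pi_apply j).comp (measurable_fst.comp measurable_snd))
  have h2 (j : ℕ+) : Measurable
      fun w : (∀ i, Sinf.Share i) × (∀ i, ∀ o, (SG i).Share o) × (ℕ+ → M) => w.2.2 j :=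
    (measurable_pi_apply j).comp (measurable_snd.comp measurable_snd)
  have h3 (j : ℕ+) : Measurable
      fun w : (∀ i, Sinf.Share i) × (∀ i, ∀ o, (SG i).Share o) × (ℕ+ → M) => e j (w.2.1 j none) :=
    (measurable_of_countable (e j)).comp (h1 j none)
  have h4 : Measurable fun q : M × M => q.1 + q.2 := measurable_of_countable _
  have h5 : Measurable
      fun w : (∀ i, Sinf.Share i) × (∀ i, ∀ o, (SG i).Share o) × (ℕ+ → M) =>
        (w.1 (gen t), (fun j : Set.Iio (gen t) => e j (w.2.1 j none)),
          w.2.1 (gen t) (some (genIndex t)),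
          (fun j : Set.Iio (gen t) => w.2.2 j + e (gen t) (w.2.1 (gen t) none)), w.2.2 (gen t)) :=
    ((measurable_pi_apply _).comp measurable_fst).prodMk
      ((measurable_pi_lambda _ fun j : Set.Iio (gen t) => h3 j).prodMk ((h1 _ _).prodMk
        ((measurable_pi_lambda _ fun j : Set.Iio (gen t) =>
          h4.comp ((h2 j).prodMk (h3 (gen t)))).prodMk (h2 (gen t)))))
  let z' : Sinf.Share (gen t) × (Set.Iio (gen t) → M) ×
    (SG (gen t)).Share (some (genIndex t)) × (Set.Iio (gen t) → M) × M := z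
  exact h5 (measurableSet_singleton z')

/-- The joint law is the product of the laws of the component views and of the masks, and each
component view has a law independent of the secret. -/
theorem map_observe_revised (hinf : Sinf.Secret 3) (hG : ∀ i, (SG i).Secret 3) (C : Finset ℕ+)
    (hC : C.card < 3) (D : ∀ i, Finset (Option (Fin (genSize i)))) (hD : ∀ i, (D i).card < 3)
    (d : ∀ i, Sinf.Share i) (d' : ∀ i, ∀ o, (SG i).Share o) (s₀ s₁ : S) :
    (revisedScheme Sinf SG e).law.map (fun ω => (Sinf.observe C d s₀ ω.1,
        (fun i => (SG i).observe (D i) (d' i) s₀ (ω.2.1 i)), ω.2.2)) =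
      (revisedScheme Sinf SG e).law.map (fun ω => (Sinf.observe C d s₁ ω.1,
        (fun i => (SG i).observe (D i) (d' i) s₁ (ω.2.1 i)), ω.2.2)) := by
  have hm (s : S) : Measurable fun (ω : ∀ i, (SG i).Coins) (i : ℕ+) =>
      (SG i).observe (D i) (d' i) s (ω i) :=
    measurable_pi_lambda _ fun i =>
      ((SG i).measurable_observe (D i) (d' i) s).comp (measurable_pi_apply i)
  have key (s : S) : (revisedScheme Sinf SG e).law.map (fun ω => (Sinf.observe C d s ω.1,
        (fun i => (SG i).observe (D i) (d' i) s (ω.2.1 i)), ω.2.2)) =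
      (Sinf.law.map (Sinf.observe C d s)).prod
        ((Measure.infinitePi fun i => (SG i).law.map ((SG i).observe (D i) (d' i) s)).prod
          (Measure.infinitePi fun _ : ℕ+ =>
            ProbabilityTheory.uniformOn (Set.univ : Set M))) := by
    have : IsProbabilityMeasure (Sinf.law.map (Sinf.observe C d s)) :=
      Measure.isProbabilityMeasure_map (Sinf.measurable_observe C d s).aemeasurable
    have (i : ℕ+) : IsProbabilityMeasure ((SG i).law.map ((SG i).observe (D i) (d' i) s)) :=
      Measure.isProbabilityMeasure_map ((SG i).measurable_observe _ _ s).aemeasurable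
    have h1 := Measure.infinitePi_map_pi (fun i => (SG i).law)
      fun i => (SG i).measurable_observe (D i) (d' i) s
    have h2 : MeasurePreserving (fun (ω : ∀ i, (SG i).Coins) (i : ℕ+) =>
      (SG i).observe (D i) (d' i) s (ω i)) (Measure.infinitePi fun i => (SG i).law)
      (Measure.infinitePi fun i => (SG i).law.map ((SG i).observe (D i) (d' i) s)) := ⟨hm s, h1⟩
    have h3 : MeasurePreserving (Sinf.observe C d s) Sinf.law
      (Sinf.law.map (Sinf.observe C d s)) := ⟨Sinf.measurable_observe C d s, rfl⟩
    exact (h3.prod (h2.prod (MeasurePreserving.id _))).map_eq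
  have h4 (i) := (hG i).map_observe_eq (D i) (hD i) (d' i) s₀ s₁
  rw [key, key, hinf.map_observe_eq C hC d s₀ s₁]
  simp only [h4]

/-- If suitably transformed coins make the shares of `C` in the revised scheme a function of at
most two shares of each component scheme and of the masks, then `C` learns nothing. -/
theorem revisedScheme_secret_of_observe (hinf : Sinf.Secret 3) (hG : ∀ i, (SG i).Secret 3)
    (C C' : Finset ℕ+) (hC' : C'.card < 3) (D : ∀ i, Finset (Option (Fin (genSize i))))
    (hD : ∀ i, (D i).card < 3) (d : ∀ i, Sinf.Share i) (d' : ∀ i, ∀ o, (SG i).Share o)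
    (Ψ : S → (revisedScheme Sinf SG e).Coins → (revisedScheme Sinf SG e).Coins)
    (hΨ : ∀ s, MeasurePreserving (Ψ s) (revisedScheme Sinf SG e).law
      (revisedScheme Sinf SG e).law)
    (h : ∀ s ω, ∀ t ∈ C, (revisedScheme Sinf SG e).share t s (Ψ s ω) =
      assemble Sinf SG e (Sinf.observe C' d s ω.1,
        (fun i => (SG i).observe (D i) (d' i) s (ω.2.1 i)), ω.2.2) t)
    (s₀ s₁ : S) (z : ∀ i, (revisedScheme Sinf SG e).Share i) :
    (revisedScheme Sinf SG e).law {ω | ∀ t ∈ C, (revisedScheme Sinf SG e).share t s₀ ω = z t} =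
      (revisedScheme Sinf SG e).law
        {ω | ∀ t ∈ C, (revisedScheme Sinf SG e).share t s₁ ω = z t} := by
  have hB : MeasurableSet {w | ∀ t ∈ C, assemble Sinf SG e w t = z t} := by
    have : {w | ∀ t ∈ C, assemble Sinf SG e w t = z t} =
        ⋂ t ∈ C, {w | assemble Sinf SG e w t = z t} := by ext; simp
    rw [this]
    exact Finset.measurableSet_biInter C fun t _ => measurableSet_assemble_eq Sinf SG e t (z t)
  have hm (s : S) : Measurable fun ω : (revisedScheme Sinf SG e).Coins =>
      (Sinf.observe C' d s ω.1, (fun i => (SG i).observe (D i) (d' i) s (ω.2.1 i)), ω.2.2) :=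
    ((Sinf.measurable_observe C' d s).comp measurable_fst).prodMk
      ((measurable_pi_lambda _ fun i => ((SG i).measurable_observe (D i) (d' i) s).comp
        ((measurable_pi_apply i).comp (measurable_fst.comp measurable_snd))).prodMk
          (measurable_snd.comp measurable_snd))
  have key (s : S) :
      (revisedScheme Sinf SG e).law
        {ω | ∀ t ∈ C, (revisedScheme Sinf SG e).share t s ω = z t} =
      (revisedScheme Sinf SG e).law.map (fun ω => (Sinf.observe C' d s ω.1,
        (fun i => (SG i).observe (D i) (d' i) s (ω.2.1 i)), ω.2.2))
        {w | ∀ t ∈ C, assemble Sinf SG e w t = z t} := by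
    rw [Measure.map_apply (hm s) hB, ← (hΨ s).measure_preimage
      ((revisedScheme Sinf SG e).measurableSet_forall_share_eq s (p := (· ∈ C))
        C.countable_toSet z).nullMeasurableSet]
    congr 1
    ext ω
    exact forall₂_congr fun t ht => by rw [h s ω t ht]
  rw [key, key, map_observe_revised Sinf SG e hinf hG C' hC' D hD d d' s₀ s₁]

/-- The sets `D i` collect the shares of generation scheme `i` on which the view depends. The
forward share is left out exactly when all of `C` lies in generation `i`, where the masks hide it.
-/
theorem revisedScheme_secret (hinf : Sinf.Secret 3) (hG : ∀ i, (SG i).Secret 3) :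
    (revisedScheme Sinf SG e).Secret 3 := by
  classical
  intro C hC s₀ s₁ z
  let d : ∀ i, Sinf.Share i := fun i => Sinf.share i s₀ Sinf.nonempty_coins.some
  let d' : ∀ i, ∀ o, (SG i).Share o := fun i o => (SG i).share o s₀ (SG i).nonempty_coins.some
  have hC' : (C.image gen).card < 3 := Finset.card_image_le.trans_lt hC
  by_cases hg : ∃ g, ∀ t ∈ C, gen t = g
  · obtain ⟨g, hg⟩ := hg
    have hD (i : ℕ+) : ∃ D : Finset (Option (Fin (genSize i))), D.card < 3 ∧
        (i ≠ g → none ∈ D) ∧ (i = g → none ∉ D) ∧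
        ∀ t ∈ C, ∀ h : gen t = i, some (genMember i t h) ∈ D := by
      by_cases hi : i = g
      · subst hi
        refine ⟨C.attach.image fun t : C => some (genMember i t (hg t t.2)), ?_, by simp, by simp, ?_⟩
        · exact Finset.card_image_le.trans_lt (by simpa using hC)
        · intro t ht h
          exact Finset.mem_image.2 ⟨⟨t, ht⟩, by simp, rfl⟩
      · refine ⟨{none}, by simp, by simp, fun h => absurd h hi, fun t ht h => ?_⟩
        exact absurd (h.symm.trans (hg t ht)) hi
    choose D hD1 hD2 hD3 hD4 using hD
    -- Adding this to the masks turns each masked forward share of `g` into `SR j + e g (d' g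
    -- none)`. Only masks with `j < g` move; `SR g`, which is visible, stays.
    let ψ (s : S) (ω : ∀ i, (SG i).Coins) (j : ℕ+) : M :=
      if j < g then e g (d' g none) - e g ((SG g).share none s (ω g)) else 0
    have hψ (s : S) : Measurable (ψ s) := by
      refine measurable_pi_lambda _ fun j => ?_
      by_cases hj : j < g
      · simp only [ψ, hj, if_true]
        exact (measurable_of_countable fun x => e g (d' g none) - e g x).comp
          (((SG g).measurable_share' none s).comp (measurable_pi_apply g))
      · simp only [ψ, hj, if_false]
        exact measurable_const
    refine revisedScheme_secret_of_observe Sinf SG e hinf hG C _ hC' D hD1 d d'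
      (fun s ω => (ω.1, ω.2.1, ω.2.2 + ψ s ω.2.1)) (fun s => ?_) (fun s ω t ht => ?_) s₀ s₁ z
    · have hadd : Measurable fun q : M × M => q.1 + q.2 := measurable_of_countable _
      -- The translation depends on the coins of scheme `g`, but preserves the law of the masks for
      -- each fixed value of them.
      refine (MeasurePreserving.id Sinf.law).prod
        ((MeasurePreserving.id (Measure.infinitePi fun i => (SG i).law)).skew_product
          (g := fun ω m => m + ψ s ω) ?_ (Filter.Eventually.of_forall fun ω =>
            (measurePreserving_add_infinitePi_uniformOn (ψ s ω)).map_eq))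
      refine measurable_pi_lambda _ fun j => hadd.comp (Measurable.prodMk ?_ ?_)
      · exact (measurable_pi_apply j).comp measurable_snd
      · exact (measurable_pi_apply j).comp ((hψ s).comp measurable_fst)
    · obtain rfl := hg t ht
      have h1 : Sinf.observe (C.image gen) d s ω.1 (gen t) = Sinf.share (gen t) s ω.1 :=
        observe_of_mem _ _ _ _ (Finset.mem_coe.2 (Finset.mem_image_of_mem _ ht))
      have h2 (j : ℕ+) (hj : j < gen t) : (SG j).observe (D j) (d' j) s (ω.2.1 j) none =
          (SG j).share none s (ω.2.1 j) := observe_of_mem _ _ _ _ (hD2 j hj.ne)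
      have h3 : (SG (gen t)).observe (D (gen t)) (d' (gen t)) s (ω.2.1 (gen t)) none =
          d' (gen t) none := if_neg (by simpa using hD3 _ rfl)
      have h4 : (SG (gen t)).observe (D (gen t)) (d' (gen t)) s (ω.2.1 (gen t))
          (some (genIndex t)) = (SG (gen t)).share (some (genIndex t)) s (ω.2.1 (gen t)) :=
        observe_of_mem _ _ _ _ (hD4 (gen t) t ht rfl)
      simp only [assemble, revisedScheme, h1, h3, h4, Prod.mk.injEq, true_and]
      refine ⟨funext fun j => by rw [h2 j j.2], funext fun j => ?_, ?_⟩
      · have hj : (j : ℕ+) < gen t := j.2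
        simp [ψ, hj, add_assoc]
      · simp [ψ]
  · have hD (i : ℕ+) : ∃ D : Finset (Option (Fin (genSize i))), D.card < 3 ∧ none ∈ D ∧
        ∀ t ∈ C, ∀ h : gen t = i, some (genMember i t h) ∈ D := by
      by_cases hi : ∃ t ∈ C, gen t = i
      · obtain ⟨t, ht, h⟩ := hi
        refine ⟨{none, some (genMember i t h)}, Finset.card_le_two.trans_lt (by norm_num),
          by simp, fun u hu h' => ?_⟩
        -- Two distinct members of `C` in generation `i` would exhaust `C` and put all of it in one
        -- generation.
        suffices u = t by subst this; simp
        by_contra hut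
        refine hg ⟨i, fun v hv => ?_⟩
        have hCtu : C = {u, t} := by
          symm
          refine Finset.eq_of_subset_of_card_le (by simp [Finset.insert_subset_iff, hu, ht]) ?_
          rw [Finset.card_pair hut]
          omega
        rw [hCtu] at hv
        simp only [Finset.mem_insert, Finset.mem_singleton] at hv
        rcases hv with rfl | rfl
        · exact h'
        · exact h
      · exact ⟨{none}, by simp, by simp, fun t ht h => absurd ⟨t, ht, h⟩ hi⟩
    choose D hD1 hD2 hD3 using hD
    refine revisedScheme_secret_of_observe Sinf SG e hinf hG C _ hC' D hD1 d d'
      (fun _ ω => ω) (fun s => MeasurePreserving.id _) (fun s ω t ht => ?_) s₀ s₁ z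
    have h1 : Sinf.observe (C.image gen) d s ω.1 (gen t) = Sinf.share (gen t) s ω.1 :=
      observe_of_mem _ _ _ _ (Finset.mem_coe.2 (Finset.mem_image_of_mem _ ht))
    have h2 (j : ℕ+) : (SG j).observe (D j) (d' j) s (ω.2.1 j) none =
        (SG j).share none s (ω.2.1 j) := observe_of_mem _ _ _ _ (hD2 j)
    have h3 : (SG (gen t)).observe (D (gen t)) (d' (gen t)) s (ω.2.1 (gen t))
        (some (genIndex t)) = (SG (gen t)).share (some (genIndex t)) s (ω.2.1 (gen t)) :=
      observe_of_mem _ _ _ _ (hD3 (gen t) t ht rfl)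
    simp only [assemble, revisedScheme, h1, h2, h3]

theorem revisedScheme_isEvolvingThreshold [Nonempty S] (hinf : Sinf.IsEvolvingThreshold 3)
    (hG : ∀ i, (SG i).IsThreshold 3) : (revisedScheme Sinf SG e).IsEvolvingThreshold 3 :=
  ⟨composes _, revisedScheme_correct Sinf SG e hinf.2.1 fun i => (hG i).1,
    revisedScheme_secret Sinf SG e hinf.2.2 fun i => (hG i).2⟩

/-- The share contains `g - 1` forward shares, `g - 1` masked ones and one mask, hence `2 g - 1`
elements of `M`. -/
theorem revisedScheme_bits [Nonempty S] (t : ℕ+) :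
    (revisedScheme Sinf SG e).bits t =
      Sinf.bits (gen t) + (SG (gen t)).bits (some (genIndex t)) +
        (2 * ((gen t : ℕ) : ℝ) - 1) * Real.logb 2 (Nat.card M) := by
  have h1 : (Nat.card (Sinf.Share (gen t)) : ℝ) ≠ 0 := by
    have := Sinf.nonempty_share (gen t)
    exact_mod_cast Nat.card_pos.ne'
  have h2 : (Nat.card ((SG (gen t)).Share (some (genIndex t))) : ℝ) ≠ 0 := by
    have := (SG (gen t)).nonempty_share (some (genIndex t))
    exact_mod_cast Nat.card_pos.ne'
  have h3 : (Nat.card M : ℝ) ≠ 0 := by exact_mod_cast Nat.card_pos.ne'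
  have h4 : Nat.card (Set.Iio (gen t)) = (gen t : ℕ) - 1 := by
    have : Set.Iio (gen t) = (Finset.Ico 1 (gen t) : Finset ℕ+) := by ext; simp
    rw [this, Nat.card_coe_set_eq, Set.ncard_coe_finset, PNat.card_Ico]
    rfl
  have h5 : Nat.card ((revisedScheme Sinf SG e).Share t) =
      Nat.card (Sinf.Share (gen t)) * (Nat.card M ^ ((gen t : ℕ) - 1) *
        (Nat.card ((SG (gen t)).Share (some (genIndex t))) *
          (Nat.card M ^ ((gen t : ℕ) - 1) * Nat.card M))) := by
    simp only [revisedScheme, Nat.card_prod, Nat.card_fun, h4]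
  have h6 := (gen t).pos
  rw [bits, h5, bits, bits]
  push_cast
  rw [Real.logb_mul h1 (by positivity), Real.logb_mul (by positivity) (by positivity),
    Real.logb_mul h2 (by positivity), Real.logb_mul (by positivity) h3, Real.logb_pow,
    Nat.cast_sub (by omega)]
  push_cast
  ring

end Revised

end DealScheme

/-! ### An evolving scheme with shares of quadratic length -/

namespace DealScheme

section Evolving

variable (G : Type) [AddCommGroup G] [Finite G]

/-- An evolving 3-threshold scheme for secrets in a finite abelian group. From uniform
independent `c i j`, participant `t` gets `c i t` for `i ≤ t` and `s + c i i + c i j` for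
`i < j < t`. -/
noncomputable def tripleScheme : DealScheme G ℕ+ :=
  letI : MeasurableSpace G := ⊤
  { Coins := ℕ+ × ℕ+ → G
    law := Measure.infinitePi fun _ => ProbabilityTheory.uniformOn Set.univ
    Share := fun t => (Set.Iic t → G) × (Set.Iio t × Set.Iio t → G)
    share := fun t s c => (fun i => c (i, t),
      fun q => if (q.1 : ℕ+) < q.2 then s + c (q.1, q.1) + c (q.1, q.2) else 0)
    measurable_share := fun t s z => by
      have h1 (q : ℕ+ × ℕ+) : Measurable fun c : ℕ+ × ℕ+ → G => c q := measurable_pi_apply q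
      have h2 : Measurable fun q : G × G => s + q.1 + q.2 := measurable_of_countable _
      have h3 : Measurable fun c : ℕ+ × ℕ+ → G => ((fun i : Set.Iic t => c (i, t)),
          fun q : Set.Iio t × Set.Iio t =>
            if (q.1 : ℕ+) < q.2 then s + c (q.1, q.1) + c (q.1, q.2) else 0) := by
        refine (measurable_pi_lambda _ fun i : Set.Iic t => h1 (i, t)).prodMk
          (measurable_pi_lambda _ fun q => ?_)
        split_ifs
        · exact h2.comp ((h1 _).prodMk (h1 _))
        · exact measurable_const
      exact h3 (measurableSet_singleton z) }

variable {G} in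
theorem tripleScheme_share_eq_iff {t : ℕ+} {s s' : G} {c c' : ℕ+ × ℕ+ → G} :
    (tripleScheme G).share t s c = (tripleScheme G).share t s' c' ↔
      (∀ i ≤ t, c (i, t) = c' (i, t)) ∧ ∀ i j, i < j → j < t →
        s + c (i, i) + c (i, j) = s' + c' (i, i) + c' (i, j) := by
  simp only [tripleScheme, Prod.mk.injEq, funext_iff, Subtype.forall, Set.mem_Iic, Prod.forall,
    Set.mem_Iio]
  refine and_congr_right fun _ => ⟨fun h i j hij hj => ?_, fun h i hi j hj => ?_⟩
  · simpa [hij] using h i (hij.trans hj) j hj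
  · split_ifs with hij
    · exact h i j hij hj
    · rfl

theorem exists_lt_lt_of_three_le_card {α : Type*} [LinearOrder α] {A : Finset α}
    (hA : 3 ≤ A.card) : ∃ i ∈ A, ∃ j ∈ A, ∃ k ∈ A, i < j ∧ j < k := by
  let f := A.orderEmbOfFin rfl
  exact ⟨f ⟨0, by omega⟩, A.orderEmbOfFin_mem rfl _, f ⟨1, by omega⟩, A.orderEmbOfFin_mem rfl _,
    f ⟨2, by omega⟩, A.orderEmbOfFin_mem rfl _, f.strictMono (by simp [Fin.lt_def]),
    f.strictMono (by simp [Fin.lt_def])⟩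

/-- For `i < j < k`, participant `i` holds `c i i`, `j` holds `c i j`, and `k` holds the secret
masked by their sum. -/
theorem tripleScheme_correct : (tripleScheme G).Correct 3 := by
  rw [correct_iff]
  refine fun A hA => ⟨fun _ => Set.univ, fun s => Filter.Eventually.of_forall fun _ => trivial,
    fun s s' c c' _ _ h => ?_⟩
  obtain ⟨i, hi, j, hj, k, hk, hij, hjk⟩ := exists_lt_lt_of_three_le_card hA
  have h1 := (tripleScheme_share_eq_iff.1 (h i hi)).1 i le_rfl
  have h2 := (tripleScheme_share_eq_iff.1 (h j hj)).1 i hij.le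
  have h3 := (tripleScheme_share_eq_iff.1 (h k hk)).2 i j hij hjk
  rw [h1, h2] at h3
  exact add_right_cancel (add_right_cancel h3)

theorem exists_le_forall_mem_of_card_lt_three {C : Finset ℕ+} (hC : C.card < 3) :
    ∃ u t : ℕ+, u ≤ t ∧ ∀ i ∈ C, i = u ∨ i = t := by
  have h : C.card = 0 ∨ C.card = 1 ∨ C.card = 2 := by omega
  rcases h with h | h | h
  · rw [Finset.card_eq_zero] at h
    exact ⟨1, 1, le_rfl, by simp [h]⟩
  · obtain ⟨a, rfl⟩ := Finset.card_eq_one.1 h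
    exact ⟨a, a, le_rfl, by simp⟩
  · obtain ⟨a, b, -, rfl⟩ := Finset.card_eq_two.1 h
    rcases le_total a b with hab | hab
    · exact ⟨a, b, hab, by simp⟩
    · exact ⟨b, a, hab, by simp [or_comm]⟩

theorem tripleScheme_secret : (tripleScheme G).Secret 3 := by
  refine secret_of_measurePreserving _ _ fun C hC s₀ s₁ => ?_
  obtain ⟨u, t, hut, hCut⟩ := exists_le_forall_mem_of_card_lt_three hC
  -- The change of secret is absorbed by coins that neither `u` nor `t` sees: in row `i < u` by `c i
  -- i`, in rows `i ≥ u` by `c i j` with `i < j < t`.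
  let d : ℕ+ × ℕ+ → G := fun q =>
    if q.1 < u then (if q.1 = q.2 then s₀ - s₁ else 0)
    else if q.1 < q.2 ∧ q.2 < t then s₀ - s₁ else 0
  have hd (i : ℕ+) : d (i, t) = 0 := by
    by_cases h : i < u
    · simp [d, h, (h.trans_le hut).ne]
    · simp [d, h]
  have hd' (i : ℕ+) (hi : i ≤ u) : d (i, u) = 0 := by
    rcases hi.lt_or_eq with h | rfl
    · simp [d, h, h.ne]
    · simp [d]
  have hdd (i j : ℕ+) (hij : i < j) (hj : j < t) : d (i, i) + d (i, j) = s₀ - s₁ := by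
    by_cases h : i < u
    · simp [d, h, hij.ne]
    · simp [d, h, hij, hj]
  let : MeasurableSpace G := ⊤
  refine ⟨fun c : ℕ+ × ℕ+ → G => c + d, measurePreserving_add_infinitePi_uniformOn d,
    fun (c : ℕ+ × ℕ+ → G) i hi => ?_⟩
  have hsum (i j : ℕ+) (hij : i < j) (hj : j < t) :
      s₁ + (c + d) (i, i) + (c + d) (i, j) = s₀ + c (i, i) + c (i, j) := by
    have h := hdd i j hij hj
    rw [eq_sub_iff_add_eq] at h
    simp only [Pi.add_apply, ← h]
    abel
  refine tripleScheme_share_eq_iff.2 ?_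
  rcases hCut i hi with rfl | rfl
  · exact ⟨fun j hj => by simp [hd' j hj], fun j k hjk hk => hsum j k hjk (hk.trans_le hut)⟩
  · exact ⟨fun j _ => by simp [hd j], fun j k hjk hk => hsum j k hjk hk⟩

theorem tripleScheme_isEvolvingThreshold : (tripleScheme G).IsEvolvingThreshold 3 :=
  ⟨composes _, tripleScheme_correct G, tripleScheme_secret G⟩

theorem bits_nonneg {S : Type*} {ι : Type} (Z : DealScheme S ι) (i : ι) : 0 ≤ Z.bits i := by
  rcases Nat.eq_zero_or_pos (Nat.card (Z.Share i)) with h | h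
  · simp [bits, h]
  · exact Real.logb_nonneg (by norm_num) (by exact_mod_cast h)

theorem tripleScheme_bits_le (t : ℕ+) :
    (tripleScheme G).bits t ≤ 2 * Real.logb 2 (Nat.card G) * ((t : ℕ) : ℝ) ^ 2 := by
  have h1 : Nat.card (Set.Iic t) = (t : ℕ) := by
    have : Set.Iic t = (Finset.Icc 1 t : Finset ℕ+) := by ext; simp
    rw [this, Nat.card_coe_set_eq, Set.ncard_coe_finset, PNat.card_Icc]
    simp
  have h2 : Nat.card (Set.Iio t) = (t : ℕ) - 1 := by
    have : Set.Iio t = (Finset.Ico 1 t : Finset ℕ+) := by ext; simp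
    rw [this, Nat.card_coe_set_eq, Set.ncard_coe_finset, PNat.card_Ico]
    rfl
  have h3 : Nat.card ((tripleScheme G).Share t) =
      Nat.card G ^ ((t : ℕ) + ((t : ℕ) - 1) * ((t : ℕ) - 1)) := by
    simp only [tripleScheme, Nat.card_prod, Nat.card_fun, h1, h2, pow_add]
  have h4 : 0 ≤ Real.logb 2 (Nat.card G) :=
    Real.logb_nonneg (by norm_num) (by exact_mod_cast Nat.card_pos)
  rw [bits, h3]
  push_cast
  rw [Real.logb_pow, mul_right_comm]
  refine mul_le_mul_of_nonneg_right ?_ h4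
  have h5 : (t : ℕ) + ((t : ℕ) - 1) * ((t : ℕ) - 1) ≤ 2 * (t : ℕ) ^ 2 := by
    obtain ⟨n, hn⟩ : ∃ n, (t : ℕ) = n + 1 := ⟨(t : ℕ) - 1, by have := t.pos; omega⟩
    rw [hn]
    simp only [Nat.add_sub_cancel]
    nlinarith
  exact_mod_cast h5

end Evolving

end DealScheme

/-! ### Quadratic polynomials with constrained evaluation points -/

/-- Distinct points of a finite extension `E` of `K` on which the linear functional `φ` is
constantly `μ` and the linear functional `ψ` vanishes. -/
structure PointSystem (K : Type) [Field K] (ι : Type) (μ : K) where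
  E : Type
  [field : Field E]
  [finite : Finite E]
  [algebra : Algebra K E]
  φ : E →ₗ[K] K
  ψ : E →ₗ[K] K
  exists_eq : ∀ a b, ∃ x, φ x = a ∧ ψ x = b
  pt : ι → E
  injective : pt.Injective
  φ_pt : ∀ i, φ (pt i) = μ
  ψ_pt : ∀ i, ψ (pt i) = 0

namespace PointSystem

attribute [instance] PointSystem.field PointSystem.finite PointSystem.algebra

variable {K : Type} [Field K] {ι : Type} {μ : K} (B : PointSystem K ι μ)

/-- The value at the point of `i` of a quadratic polynomial over `E` with leading coefficient
in `K`, and the values of `φ` and `ψ` on its linear coefficient, masking `s` and `u`. -/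
def blockShare (i : ι) (c : B.E × B.E) (c₂ s u : K) : B.E × K × K :=
  (c.2 + c.1 * B.pt i + c₂ • B.pt i ^ 2, B.φ c.1 - s, B.ψ c.1 - u)

theorem slope_eq {i j : ι} (hij : i ≠ j) {c c' : B.E × B.E} {c₂ c₂' s s' u u' : K}
    (hi : B.blockShare i c c₂ s u = B.blockShare i c' c₂' s' u')
    (hj : B.blockShare j c c₂ s u = B.blockShare j c' c₂' s' u') :
    (c.1 - c'.1) + (c₂ - c₂') • (B.pt i + B.pt j) = 0 := by
  have h1 := congrArg Prod.fst hi
  have h2 := congrArg Prod.fst hj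
  have h3 : B.pt i - B.pt j ≠ 0 := sub_ne_zero.2 (B.injective.ne hij)
  simp only [blockShare, Algebra.smul_def] at h1 h2
  refine (mul_eq_zero.1 ?_).resolve_left h3
  rw [Algebra.smul_def, map_sub]
  linear_combination h1 - h2

/-- Two participants learn `u` and a combination of `s` and the leading coefficient. -/
theorem eq_of_pair {i j : ι} (hij : i ≠ j) {c c' : B.E × B.E} {c₂ c₂' s s' u u' : K}
    (hi : B.blockShare i c c₂ s u = B.blockShare i c' c₂' s' u')
    (hj : B.blockShare j c c₂ s u = B.blockShare j c' c₂' s' u') :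
    u = u' ∧ s + 2 * μ * c₂ = s' + 2 * μ * c₂' := by
  have h := B.slope_eq hij hi hj
  have h1 := congrArg B.φ h
  have h2 := congrArg B.ψ h
  simp only [map_add, map_sub, map_smul, B.φ_pt, B.ψ_pt, smul_eq_mul, map_zero] at h1 h2
  simp only [blockShare, Prod.mk.injEq] at hi
  obtain ⟨-, h3, h4⟩ := hi
  constructor
  · linear_combination h2 - h4
  · linear_combination h1 - h3

/-- Three participants learn `s`. -/
theorem eq_of_triple {i j k : ι} (hij : i ≠ j) (hik : i ≠ k) (hjk : j ≠ k) {c c' : B.E × B.E}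
    {c₂ c₂' s s' u u' : K}
    (hi : B.blockShare i c c₂ s u = B.blockShare i c' c₂' s' u')
    (hj : B.blockShare j c c₂ s u = B.blockShare j c' c₂' s' u')
    (hk : B.blockShare k c c₂ s u = B.blockShare k c' c₂' s' u') : s = s' := by
  have h1 := B.slope_eq hij hi hj
  have h2 := B.slope_eq hik hi hk
  have h3 : (c₂ - c₂') • (B.pt j - B.pt k) = 0 := by
    rw [Algebra.smul_def] at *
    linear_combination h1 - h2
  have h4 : c₂ = c₂' :=
    sub_eq_zero.1 ((smul_eq_zero.1 h3).resolve_right (sub_ne_zero.2 (B.injective.ne hjk)))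
  subst h4
  exact add_right_cancel (B.eq_of_pair hij hi hj).2

/-- A single participant learns nothing, even if the leading coefficient is known. -/
theorem exists_shift_of_subsingleton {Y : Set ι} (hY : Y.Subsingleton) (x y z : K) :
    ∃ d : B.E × B.E, ∀ i ∈ Y, ∀ c c₂ s u,
      B.blockShare i (c + d) (c₂ + x) (s + y) (u + z) = B.blockShare i c c₂ s u := by
  rcases hY.eq_empty_or_singleton with rfl | ⟨j, rfl⟩
  · exact ⟨0, by simp⟩
  · obtain ⟨b, hb1, hb2⟩ := B.exists_eq y z
    -- The linear coefficient absorbs the changes of `s` and `u`; the constant term restores the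
    -- value at the only point.
    refine ⟨(b, -(b * B.pt j) - x • B.pt j ^ 2), ?_⟩
    rintro i rfl c c₂ s u
    simp only [blockShare, Prod.fst_add, Prod.snd_add, map_add, hb1, hb2, Prod.mk.injEq,
      Algebra.smul_def]
    exact ⟨by ring, by ring, by ring⟩

/-- Two participants learn nothing about `s`. -/
theorem exists_shift_of_pair (hμ : 2 * μ ≠ 0) (j k : ι) (y : K) :
    ∃ d : B.E × B.E, ∀ i, i = j ∨ i = k → ∀ c c₂ s u,
      B.blockShare i (c + d) (c₂ + -(y / (2 * μ))) (s + y) u = B.blockShare i c c₂ s u := by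
  obtain ⟨x, rfl⟩ : ∃ x, y = 2 * μ * x := ⟨y / (2 * μ), by rw [mul_comm, div_mul_cancel₀ _ hμ]⟩
  rw [mul_div_cancel_left₀ _ hμ]
  -- The polynomial changes by `-x (X - pt j) (X - pt k)`, which vanishes at both points.
  refine ⟨(x • (B.pt j + B.pt k), -(x • (B.pt j * B.pt k))), ?_⟩
  intro i hi c c₂ s u
  have h1 : B.φ (x • (B.pt j + B.pt k)) = 2 * μ * x := by
    rw [map_smul, map_add, B.φ_pt, B.φ_pt, smul_eq_mul]
    ring
  have h2 : B.ψ (x • (B.pt j + B.pt k)) = 0 := by simp [B.ψ_pt]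
  simp only [blockShare, Prod.fst_add, Prod.snd_add, map_add B.φ, map_add B.ψ, h1, h2,
    Prod.mk.injEq]
  refine ⟨?_, by ring, by ring⟩
  simp only [Algebra.smul_def, map_neg, map_add]
  rcases hi with rfl | rfl <;> ring

/-- Over a prime field there are point systems of any size whose field has few more elements
than needed. -/
theorem exists_card_eq (q : ℕ) [Fact q.Prime] (n : ℕ) (μ : ZMod q) :
    ∃ B : PointSystem (ZMod q) (Fin n) μ, Nat.card B.E = q ^ (Nat.clog q n + 2) := by
  have hq : q.Prime := Fact.out
  set m := Nat.clog q n
  let E := GaloisField q (m + 2)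
  have hfin : Module.finrank (ZMod q) E = m + 2 := GaloisField.finrank q (by omega)
  let f : E ≃ₗ[ZMod q] (Fin (m + 2) → ZMod q) := (Module.finBasisOfFinrankEq _ _ hfin).equivFun
  have hcard : Nat.card (Fin n) ≤ Nat.card (Fin m → ZMod q) := by
    simpa [Nat.card_fun] using Nat.le_pow_clog hq.one_lt n
  obtain ⟨v⟩ : Nonempty (Fin n ↪ (Fin m → ZMod q)) :=
    Function.Embedding.nonempty_of_card_le (by simpa [Nat.card_eq_fintype_card] using hcard)
  -- Two coordinates carry `φ` and `ψ`; the other `m` suffice to tell `n` points apart.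
  let w (a b : ZMod q) (x : Fin m → ZMod q) : Fin (m + 2) → ZMod q :=
    Fin.cons a (Fin.cons b x : Fin (m + 1) → ZMod q)
  refine ⟨{ E := E
            φ := LinearMap.proj 0 ∘ₗ f.toLinearMap
            ψ := LinearMap.proj 1 ∘ₗ f.toLinearMap
            exists_eq := fun a b => ⟨f.symm (w a b 0), ?_, ?_⟩
            pt := fun i => f.symm (w μ 0 (v i))
            injective := fun i j hij => ?_
            φ_pt := fun i => ?_
            ψ_pt := fun i => ?_ }, GaloisField.card q _ (by omega)⟩
  · simp [w]
  · simp only [LinearMap.comp_apply, LinearEquiv.coe_coe, LinearEquiv.apply_symm_apply,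
      LinearMap.proj_apply, w]
    rfl
  · have h1 := f.symm.injective hij
    exact v.injective (Fin.cons_injective2 (Fin.cons_injective2 h1).2).2
  · simp [w]
  · simp only [LinearMap.comp_apply, LinearEquiv.coe_coe, LinearEquiv.apply_symm_apply,
      LinearMap.proj_apply, w]
    rfl

end PointSystem

/-! ### The two-level scheme -/

namespace DealScheme

section TwoLevel

variable {S K A P : Type} [AddCommGroup S] [Finite S] [Field K] [Finite K] [Finite A] {J : A → Type}
  (κ : S ↪ K) (base : ∀ a, PointSystem K (J a) 1) (top : PointSystem K A 2) (lev : P → A)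
  (idx : ∀ a, P → J a)

/-- A 3-threshold scheme for the participants `P`, which are divided into the levels `A`, and
one more participant `none`. The latter receives a uniform element `r` of the group of secrets.
Any two members of `P` learn `s + r` and any three learn `s`, from their shares in the point system
of their level and in the point system `top` that treats each level as one participant. -/
noncomputable def twoLevelScheme : DealScheme S (Option P) where
  Coins := (∀ a, (base a).E × (base a).E) × (top.E × top.E) × K × S
  coinsMeasurable := ⊤
  law := @ProbabilityTheory.uniformOn _ ⊤ Set.univ
  lawProb :=
    letI : MeasurableSpace ((∀ a, (base a).E × (base a).E) × (top.E × top.E) × K × S) := ⊤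
    isProbabilityMeasure_uniformOn_univ
  Share
    | none => S
    | some i => ((base (lev i)).E × K × K) × (top.E × K × K)
  shareFinite
    | none => inferInstanceAs (Finite S)
    | some i => inferInstanceAs (Finite (((base (lev i)).E × K × K) × (top.E × K × K)))
  share
    | none => fun _ c => c.2.2.2
    | some i => fun s c =>
      ((base (lev i)).blockShare (idx (lev i) i) (c.1 (lev i)) c.2.2.1 (κ s) (κ (s + c.2.2.2)),
        top.blockShare (lev i) c.2.1 c.2.2.1 (κ s) (κ (s + c.2.2.2)))
  measurable_share _ _ _ := trivial

variable {κ base top lev idx}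

theorem twoLevelScheme_share_some_eq_iff {i : P} {a : A} (ha : lev i = a) {s s' : S}
    {c c' : (∀ a, (base a).E × (base a).E) × (top.E × top.E) × K × S} :
    (twoLevelScheme κ base top lev idx).share (some i) s c =
        (twoLevelScheme κ base top lev idx).share (some i) s' c' ↔
      (base a).blockShare (idx a i) (c.1 a) c.2.2.1 (κ s) (κ (s + c.2.2.2)) =
        (base a).blockShare (idx a i) (c'.1 a) c'.2.2.1 (κ s') (κ (s' + c'.2.2.2)) ∧
      top.blockShare a c.2.1 c.2.2.1 (κ s) (κ (s + c.2.2.2)) =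
        top.blockShare a c'.2.1 c'.2.2.1 (κ s') (κ (s' + c'.2.2.2)) := by
  subst ha
  exact Prod.mk.injEq _ _ _ _ ▸ Iff.rfl

theorem twoLevelScheme_correct (hinj : ∀ a, Set.InjOn (idx a) {i | lev i = a}) :
    (twoLevelScheme κ base top lev idx).Correct 3 := by
  classical
  rw [correct_iff]
  refine fun C hC => ⟨fun _ => Set.univ, fun s => Filter.Eventually.of_forall fun _ => trivial,
    fun s s' (c : (∀ a, (base a).E × (base a).E) × (top.E × top.E) × K × S)
      (c' : (∀ a, (base a).E × (base a).E) × (top.E × top.E) × K × S) _ _ h => ?_⟩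
  have hne {i j : P} {a : A} (hi : lev i = a) (hj : lev j = a) (hij : i ≠ j) :
      idx a i ≠ idx a j := fun h => hij (hinj a hi hj h)
  have pair {i j : P} (hi : some i ∈ C) (hj : some j ∈ C) (hij : i ≠ j) :
      κ (s + c.2.2.2) = κ (s' + c'.2.2.2) ∧
      ((lev i = lev j ∧ κ s + 2 * 1 * c.2.2.1 = κ s' + 2 * 1 * c'.2.2.1) ∨
        (lev i ≠ lev j ∧ κ s + 2 * 2 * c.2.2.1 = κ s' + 2 * 2 * c'.2.2.1)) := by
    obtain ⟨a, ha⟩ : ∃ a, lev i = a := ⟨_, rfl⟩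
    obtain ⟨b, hb⟩ : ∃ b, lev j = b := ⟨_, rfl⟩
    have h1 := (twoLevelScheme_share_some_eq_iff ha).1 (h _ hi)
    have h2 := (twoLevelScheme_share_some_eq_iff hb).1 (h _ hj)
    by_cases hab : a = b
    · subst hab
      have h3 := (base a).eq_of_pair (hne ha hb hij) h1.1 h2.1
      exact ⟨h3.1, Or.inl ⟨ha.trans hb.symm, h3.2⟩⟩
    · have h3 := top.eq_of_pair hab h1.2 h2.2
      exact ⟨h3.1, Or.inr ⟨by rwa [ha, hb], h3.2⟩⟩
  by_cases hnone : none ∈ C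
  · have hC' : 1 < (Finset.eraseNone C).card := by
      have := Finset.card_eraseNone_of_mem hnone
      omega
    obtain ⟨i, hi, j, hj, hij⟩ := Finset.one_lt_card.1 hC'
    have h1 := κ.injective (pair (Finset.mem_eraseNone.1 hi) (Finset.mem_eraseNone.1 hj) hij).1
    have h2 : c.2.2.2 = c'.2.2.2 := h none hnone
    rw [h2] at h1
    exact add_right_cancel h1
  · have hC' : 2 < (Finset.eraseNone C).card := by
      have := Finset.card_eraseNone_of_not_mem hnone
      omega
    obtain ⟨i, hi, j, hj, k, hk, hij, hik, hjk⟩ := Finset.two_lt_card.1 hC'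
    rw [Finset.mem_eraseNone] at hi hj hk
    refine κ.injective ?_
    have h1 := (pair hi hj hij).2
    have h2 := (pair hi hk hik).2
    have h3 := (pair hj hk hjk).2
    have triple (hij' : lev i = lev j) (hik' : lev i = lev k) : κ s = κ s' :=
      (base (lev i)).eq_of_triple (hne rfl hij'.symm hij) (hne rfl hik'.symm hik)
        (hne hij'.symm hik'.symm hjk)
        ((twoLevelScheme_share_some_eq_iff rfl).1 (h _ hi)).1
        ((twoLevelScheme_share_some_eq_iff hij'.symm).1 (h _ hj)).1
        ((twoLevelScheme_share_some_eq_iff hik'.symm).1 (h _ hk)).1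
    -- If a pair inside a level and a pair across levels both occur, twice `s + 2 c₂` minus `s + 4
    -- c₂` is `s`. Otherwise all three share a level, or their levels are distinct and `top` sees
    -- three points.
    rcases h1 with ⟨h1', h1⟩ | ⟨h1', h1⟩ <;> rcases h2 with ⟨h2', h2⟩ | ⟨h2', h2⟩
    · exact triple h1' h2'
    · linear_combination 2 * h1 - h2
    · linear_combination 2 * h2 - h1
    · rcases h3 with ⟨h3', h3⟩ | ⟨h3', h3⟩
      · linear_combination 2 * h3 - h1
      · exact top.eq_of_triple h1' h2' h3'
          ((twoLevelScheme_share_some_eq_iff rfl).1 (h _ hi)).2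
          ((twoLevelScheme_share_some_eq_iff rfl).1 (h _ hj)).2
          ((twoLevelScheme_share_some_eq_iff rfl).1 (h _ hk)).2

variable (κ base top lev idx) in
/-- Translations of the coins of a two-level scheme under which the shares of `C` for `s₀` and
for `s₁` agree: `ρ` translates the share of `none`, and for each value `r` of that share `x`
translates the leading coefficient. -/
theorem exists_measurePreserving_of_shift (C : Finset (Option P)) (s₀ s₁ ρ : S) (x : K)
    (hnone : none ∈ C → ρ = 0)
    (hbase : ∀ (r : S) (a : A), ∃ d : (base a).E × (base a).E, ∀ i, some i ∈ C → lev i = a →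
      ∀ c c₂ s u, (base a).blockShare (idx a i) (c + d) (c₂ + x) (s + (κ s₁ - κ s₀))
        (u + (κ (s₁ + (r + ρ)) - κ (s₀ + r))) = (base a).blockShare (idx a i) c c₂ s u)
    (htop : ∀ r : S, ∃ d : top.E × top.E, ∀ i, some i ∈ C →
      ∀ c c₂ s u, top.blockShare (lev i) (c + d) (c₂ + x) (s + (κ s₁ - κ s₀))
        (u + (κ (s₁ + (r + ρ)) - κ (s₀ + r))) = top.blockShare (lev i) c c₂ s u) :
    ∃ Φ : (twoLevelScheme κ base top lev idx).Coins → (twoLevelScheme κ base top lev idx).Coins,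
      MeasurePreserving Φ (twoLevelScheme κ base top lev idx).law
        (twoLevelScheme κ base top lev idx).law ∧
      ∀ ω, ∀ o ∈ C, (twoLevelScheme κ base top lev idx).share o s₁ (Φ ω) =
        (twoLevelScheme κ base top lev idx).share o s₀ ω := by
  choose d hd using hbase
  choose d' hd' using htop
  let Φ : (∀ a, (base a).E × (base a).E) × (top.E × top.E) × K × S →
      (∀ a, (base a).E × (base a).E) × (top.E × top.E) × K × S := fun c =>
    (c.1 + d c.2.2.2, c.2.1 + d' c.2.2.2, c.2.2.1 + x, c.2.2.2 + ρ)
  -- The shifts `d` and `d'` depend only on `r`, which is recovered first from `r + ρ`.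
  have hΦ : Φ.Injective := by
    rintro ⟨c, c', c₂, r⟩ ⟨b, b', b₂, r'⟩ h
    simp only [Φ, Prod.mk.injEq] at h
    obtain ⟨h1, h2, h3, h4⟩ := h
    obtain rfl := add_right_cancel h4
    rw [add_right_cancel h1, add_right_cancel h2, add_right_cancel h3]
  refine ⟨Φ, ?_, fun (c : (∀ a, (base a).E × (base a).E) × (top.E × top.E) × K × S) o ho => ?_⟩
  · let : MeasurableSpace ((∀ a, (base a).E × (base a).E) × (top.E × top.E) × K × S) := ⊤
    exact (measurePreserving_uniformOn_univ hΦ :)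
  · cases o with
    | none =>
      change c.2.2.2 + ρ = c.2.2.2
      rw [hnone ho, add_zero]
    | some i =>
      refine (twoLevelScheme_share_some_eq_iff (c := Φ c) rfl).2 ⟨?_, ?_⟩
      · simpa [Φ] using hd c.2.2.2 (lev i) i ho rfl (c.1 (lev i)) c.2.2.1 (κ s₀) (κ (s₀ + c.2.2.2))
      · simpa [Φ] using hd' c.2.2.2 i ho c.2.1 c.2.2.1 (κ s₀) (κ (s₀ + c.2.2.2))

/-- A lone member sees one point of each polynomial, so any change of `s` and `u` can be absorbed
without touching `r`. For two members `r` is hidden and moves so as to fix `s + r`. They see two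
points of just one polynomial, and its `μ` dictates the change of the common `c₂`; every other
polynomial shows at most one point and adapts. -/
theorem twoLevelScheme_secret (h2 : (2 : K) ≠ 0) :
    (twoLevelScheme κ base top lev idx).Secret 3 := by
  classical
  refine secret_of_measurePreserving _ _ fun C hC s₀ s₁ => ?_
  have single (C' : Set P) (hC' : C'.Subsingleton) (a : A) (x y z : K) :
      ∃ d : (base a).E × (base a).E, ∀ i ∈ C', ∀ c c₂ s u,
        (base a).blockShare (idx a i) (c + d) (c₂ + x) (s + y) (u + z) =
          (base a).blockShare (idx a i) c c₂ s u := by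
    obtain ⟨d, hd⟩ := (base a).exists_shift_of_subsingleton (hC'.image (idx a)) x y z
    exact ⟨d, fun i hi => hd _ ⟨i, hi, rfl⟩⟩
  have single' (C' : Set A) (hC' : C'.Subsingleton) (x y z : K) :=
    top.exists_shift_of_subsingleton hC' x y z
  by_cases h1 : {i | some i ∈ C}.Subsingleton
  · refine exists_measurePreserving_of_shift κ base top lev idx C s₀ s₁ 0 0 (fun _ => rfl)
      (fun r a => ?_) fun r => ?_
    · obtain ⟨d, hd⟩ := single _ h1 a 0 (κ s₁ - κ s₀) (κ (s₁ + (r + 0)) - κ (s₀ + r))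
      exact ⟨d, fun i hi _ => hd i hi⟩
    · obtain ⟨d, hd⟩ := single' _ (h1.image lev) 0 (κ s₁ - κ s₀) (κ (s₁ + (r + 0)) - κ (s₀ + r))
      exact ⟨d, fun i hi => hd _ ⟨i, hi, rfl⟩⟩
  · obtain ⟨i, hi, j, hj, hij⟩ := Set.not_subsingleton_iff.1 h1
    have hC' : C = {some i, some j} := by
      symm
      refine Finset.eq_of_subset_of_card_le ?_ ?_
      · simpa [Finset.insert_subset_iff] using ⟨hi, hj⟩
      · rw [Finset.card_pair (by simpa using hij)]
        omega
    subst hC'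
    have hmem (k : P) (hk : some k ∈ ({some i, some j} : Finset (Option P))) : k = i ∨ k = j := by
      simpa using hk
    have hu (r : S) : κ (s₁ + (r + (s₀ - s₁))) - κ (s₀ + r) = 0 := by
      rw [sub_eq_zero]
      congr 1
      abel
    by_cases hlev : lev i = lev j
    · refine exists_measurePreserving_of_shift κ base top lev idx _ s₀ s₁ (s₀ - s₁)
        (-((κ s₁ - κ s₀) / (2 * 1))) (by simp) (fun r a => ?_) fun r => ?_
      · obtain ⟨d, hd⟩ := (base a).exists_shift_of_pair (by simpa using h2) (idx a i) (idx a j)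
          (κ s₁ - κ s₀)
        refine ⟨d, fun k hk _ c c₂ s u => ?_⟩
        rw [hu, add_zero]
        exact hd _ ((hmem k hk).imp (congrArg _) (congrArg _)) c c₂ s u
      · obtain ⟨d, hd⟩ := single' {lev i} Set.subsingleton_singleton
          (-((κ s₁ - κ s₀) / (2 * 1))) (κ s₁ - κ s₀) (κ (s₁ + (r + (s₀ - s₁))) - κ (s₀ + r))
        refine ⟨d, fun k hk => hd _ ?_⟩
        rcases hmem k hk with rfl | rfl
        · rfl
        · exact hlev.symm
    · refine exists_measurePreserving_of_shift κ base top lev idx _ s₀ s₁ (s₀ - s₁)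
        (-((κ s₁ - κ s₀) / (2 * 2))) (by simp) (fun r a => ?_) fun r => ?_
      · obtain ⟨d, hd⟩ := single {k | (k = i ∨ k = j) ∧ lev k = a} (by
            rintro k ⟨hk, hka⟩ l ⟨hl, hla⟩
            rcases hk with rfl | rfl <;> rcases hl with rfl | rfl
            · rfl
            · exact absurd (hka.trans hla.symm) hlev
            · exact absurd (hla.trans hka.symm) hlev
            · rfl) a
          (-((κ s₁ - κ s₀) / (2 * 2))) (κ s₁ - κ s₀) (κ (s₁ + (r + (s₀ - s₁))) - κ (s₀ + r))
        exact ⟨d, fun k hk hka => hd k ⟨hmem k hk, hka⟩⟩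
      · obtain ⟨d, hd⟩ := top.exists_shift_of_pair (mul_ne_zero h2 h2) (lev i) (lev j)
          (κ s₁ - κ s₀)
        refine ⟨d, fun k hk c c₂ s u => ?_⟩
        rw [hu, add_zero]
        exact hd _ ((hmem k hk).imp (congrArg _) (congrArg _)) c c₂ s u

variable (κ base top lev idx) in
theorem card_twoLevelScheme_share_some (i : P) :
    Nat.card ((twoLevelScheme κ base top lev idx).Share (some i)) =
      Nat.card (base (lev i)).E * Nat.card top.E * Nat.card K ^ 4 := by
  simp only [twoLevelScheme, Nat.card_prod]
  ring

end TwoLevel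

end DealScheme

/-! ### Choice of parameters and size estimates -/

namespace DealScheme

theorem clog_mul_logb_bounds {q n : ℕ} (hq : 1 < q) (hn : 1 ≤ n) :
    Real.logb 2 n ≤ Nat.clog q n * Real.logb 2 q ∧
      Nat.clog q n * Real.logb 2 q ≤ Real.logb 2 n + Real.logb 2 q := by
  have hn' : (0 : ℝ) < n := by exact_mod_cast hn
  have hq' : (0 : ℝ) < q := by exact_mod_cast (by omega : 0 < q)
  have hL : 0 ≤ Real.logb 2 q := Real.logb_nonneg (by norm_num) (by exact_mod_cast hq.le)
  constructor
  · rw [← Real.logb_pow]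
    exact Real.logb_le_logb_of_le (by norm_num) hn' (by exact_mod_cast Nat.le_pow_clog hq n)
  · rcases hn.eq_or_lt with rfl | hn1
    · simpa using hL
    · have h1 := Nat.clog_pos hq hn1
      have h2 := Nat.pow_pred_clog_lt_self hq hn1
      have h3 : Real.logb 2 ((q : ℝ) ^ (Nat.clog q n - 1)) ≤ Real.logb 2 n :=
        Real.logb_le_logb_of_le (by norm_num) (by positivity) (by exact_mod_cast h2.le)
      rw [Real.logb_pow, Nat.cast_sub h1] at h3
      push_cast at h3
      linarith

/-- A generation can share secrets among its members and one more participant, whose share is no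
longer than the secret, with shares of about `lg t` bits for participant `t`. -/
theorem exists_generation_scheme {S : Type} [AddCommGroup S] [Finite S] (q : ℕ) [Fact q.Prime]
    (hq : q ≠ 2) (κ : S ↪ ZMod q) (i : ℕ+) :
    ∃ Z : DealScheme S (Option (Fin (genSize i))), Z.IsThreshold 3 ∧
      Nat.card (Z.Share none) = Nat.card S ∧
      ∀ t (h : gen t = i), |Z.bits (some (genMember i t h)) - Real.logb 2 (t : ℕ)| ≤
        2 * (i : ℕ) + 1 + 10 * Real.logb 2 q := by
  have hqp : q.Prime := Fact.out
  choose base hbase using fun a : Fin (4 ^ (i : ℕ) + 1) =>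
    PointSystem.exists_card_eq q (2 ^ (a : ℕ)) 1
  obtain ⟨top, htop⟩ := PointSystem.exists_card_eq q (4 ^ (i : ℕ) + 1) 2
  let time (h : Fin (genSize i)) : ℕ := genEnd ((i : ℕ) - 1) + h + 1
  have htime (h) : time h ≤ 2 ^ 4 ^ (i : ℕ) := by
    have h1 := h.2
    have h2 : genEnd i = 2 ^ 4 ^ (i : ℕ) := by simp [genEnd]
    simp only [time]
    unfold genSize at h1
    omega
  have htime0 (h) : time h ≠ 0 := Nat.succ_ne_zero _
  let lev (h : Fin (genSize i)) : Fin (4 ^ (i : ℕ) + 1) := ⟨Nat.log 2 (time h), by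
    have := (Nat.log_mono_right (b := 2) (htime h)).trans_eq (Nat.log_pow (by norm_num) _)
    omega⟩
  -- In level `a` the difference is already below `2 ^ a`; the remainder only makes the index total.
  let idx (a : Fin (4 ^ (i : ℕ) + 1)) (h : Fin (genSize i)) : Fin (2 ^ (a : ℕ)) :=
    ⟨(time h - 2 ^ (a : ℕ)) % 2 ^ (a : ℕ), Nat.mod_lt _ (by positivity)⟩
  have hlev (h) : 2 ^ (lev h : ℕ) ≤ time h ∧ time h < 2 ^ ((lev h : ℕ) + 1) :=
    ⟨Nat.pow_log_le_self 2 (htime0 h), Nat.lt_pow_succ_log_self (by norm_num) _⟩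
  have hidx (a) : Set.InjOn (idx a) {h | lev h = a} := by
    rintro h rfl h' hh' heq
    have h1 := hlev h
    have h2 := hlev h'
    rw [show lev h' = lev h from hh'] at h2
    have h3 := congrArg Fin.val heq
    simp only [idx] at h3
    rw [pow_succ] at h1 h2
    rw [Nat.mod_eq_of_lt (by omega), Nat.mod_eq_of_lt (by omega)] at h3
    ext
    simp only [time] at h1 h2 h3
    omega
  have h2 : (2 : ZMod q) ≠ 0 := by
    have : ((2 : ℕ) : ZMod q) ≠ 0 := by
      rw [Ne, ZMod.natCast_eq_zero_iff, Nat.dvd_prime Nat.prime_two]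
      have := hqp.one_lt
      omega
    exact_mod_cast this
  refine ⟨twoLevelScheme κ base top lev idx,
    ⟨twoLevelScheme_correct hidx, twoLevelScheme_secret h2⟩, rfl, fun t ht => ?_⟩
  have hL : 0 ≤ Real.logb 2 q := Real.logb_nonneg (by norm_num) (by exact_mod_cast hqp.one_le)
  have hq0 : (q : ℝ) ≠ 0 := by exact_mod_cast hqp.ne_zero
  set h := genMember i t ht
  have ht' : time h = t := by
    have h1 := genMember_val i t ht
    have h2 := (gen_eq_iff.1 ht).1
    simp only [time]
    omega
  have hlt := hlev h
  rw [ht'] at hlt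
  have ht0 : (0 : ℝ) < ((t : ℕ) : ℝ) := by exact_mod_cast t.pos
  have h3 : ((lev h : ℕ) : ℝ) ≤ Real.logb 2 (t : ℕ) := by
    rw [Real.le_logb_iff_rpow_le (by norm_num) ht0, Real.rpow_natCast]
    exact_mod_cast hlt.1
  have h4 : Real.logb 2 (t : ℕ) ≤ (lev h : ℕ) + 1 := by
    rw [Real.logb_le_iff_le_rpow (by norm_num) ht0]
    have : ((t : ℕ) : ℝ) ≤ 2 ^ ((lev h : ℕ) + 1) := by exact_mod_cast hlt.2.le
    exact_mod_cast this
  have h5 := clog_mul_logb_bounds hqp.one_lt (Nat.one_le_two_pow (n := (lev h : ℕ)))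
  have h6 : Real.logb 2 ((2 ^ (lev h : ℕ) : ℕ) : ℝ) = (lev h : ℕ) := by
    push_cast
    rw [Real.logb_pow, Real.logb_self_eq_one (by norm_num), mul_one]
  rw [h6] at h5
  have h7 := clog_mul_logb_bounds hqp.one_lt (Nat.le_add_left 1 (4 ^ (i : ℕ)))
  have h8 : Real.logb 2 ((4 ^ (i : ℕ) + 1 : ℕ) : ℝ) ≤ 2 * (i : ℕ) + 1 := by
    rw [Real.logb_le_iff_le_rpow (by norm_num) (by positivity)]
    have h9 : (4 ^ (i : ℕ) + 1 : ℕ) ≤ 2 ^ (2 * (i : ℕ) + 1) := by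
      have := Nat.one_le_pow (i : ℕ) 4 (by norm_num)
      rw [pow_succ, pow_mul]
      norm_num
    have : ((4 ^ (i : ℕ) + 1 : ℕ) : ℝ) ≤ 2 ^ (2 * (i : ℕ) + 1) := by exact_mod_cast h9
    exact_mod_cast this
  have h9 : 0 ≤ Real.logb 2 ((4 ^ (i : ℕ) + 1 : ℕ) : ℝ) :=
    Real.logb_nonneg (by norm_num) (by exact_mod_cast Nat.le_add_left 1 _)
  have hbits : (twoLevelScheme κ base top lev idx).bits (some h) =
      (Nat.clog q (2 ^ (lev h : ℕ)) + 2) * Real.logb 2 q +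
        (Nat.clog q (4 ^ (i : ℕ) + 1) + 2) * Real.logb 2 q + 4 * Real.logb 2 q := by
    rw [bits, card_twoLevelScheme_share_some, hbase, htop, Nat.card_zmod, ← pow_add, ← pow_add]
    push_cast
    rw [Real.logb_pow]
    push_cast
    ring
  -- Beyond the level and `2 i + 1`, the upper bound has `2 + 2 + 4` explicit multiples of `lg q`
  -- and one more from rounding in each `clog`: ten in all.
  rw [hbits, abs_le]
  have hi : (1 : ℝ) ≤ (i : ℕ) := by exact_mod_cast i.pos
  constructor <;> nlinarith

theorem nonempty_embedding_of_card_le {α β : Type*} [Finite α] [Finite β]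
    (h : Nat.card α ≤ Nat.card β) : Nonempty (α ↪ β) := by
  have := Fintype.ofFinite α
  have := Fintype.ofFinite β
  exact Function.Embedding.nonempty_of_card_le (by simpa [Nat.card_eq_fintype_card] using h)

theorem exists_addCommGroup_bool (ℓ : ℕ) : Nonempty (AddCommGroup (Fin ℓ → Bool)) := by
  have h : Nat.card Bool = Nat.card (ZMod 2) := by simp
  obtain ⟨f⟩ := Finite.card_eq.1 h
  exact ⟨(Equiv.arrowCongr (Equiv.refl (Fin ℓ)) f).addCommGroup⟩

/-- The prime `q` of the generation schemes depends only on `ℓ`, and `p` enters only through `M`;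
hence `C` is uniform in `p`. -/
theorem exists_short_components (ℓ : ℕ) : ∃ C : ℝ, ∀ p : ℕ, p.Prime → 2 ^ ℓ ≤ p →
      ∀ (M : Type) [AddCommGroup M] [Finite M] [MeasurableSpace M] [DiscreteMeasurableSpace M],
      p ≤ Nat.card M → Nat.card M < 2 * p →
      ∃ (Sinf : DealScheme (Fin ℓ → Bool) ℕ+)
        (SG : ∀ i : ℕ+, DealScheme (Fin ℓ → Bool) (Option (Fin (genSize i))))
        (e : ∀ i, (SG i).Share none ↪ M),
        Sinf.IsEvolvingThreshold 3 ∧ (∀ i, (SG i).IsThreshold 3) ∧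
        ∀ t : ℕ+, |(revisedScheme Sinf SG e).bits t -
              (Real.logb 2 (t : ℕ) + Real.logb 2 p * (2 * ((gen t : ℕ) : ℝ) - 1))| ≤
            C * ((gen t : ℕ) : ℝ) ^ 2 := by
  obtain ⟨inst⟩ := exists_addCommGroup_bool ℓ
  have hcard : Nat.card (Fin ℓ → Bool) = 2 ^ ℓ := by simp
  -- Large enough to embed the secrets, and odd because `q ≥ 3`.
  obtain ⟨q, hq, hqp⟩ := Nat.exists_infinite_primes (2 ^ ℓ + 2)
  have : Fact q.Prime := ⟨hqp⟩
  have hpow : 0 < 2 ^ ℓ := by positivity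
  have hL : 0 ≤ Real.logb 2 q := Real.logb_nonneg (by norm_num) (by exact_mod_cast hqp.one_le)
  obtain ⟨κ⟩ : Nonempty ((Fin ℓ → Bool) ↪ ZMod q) :=
    nonempty_embedding_of_card_le (by rw [hcard, Nat.card_zmod]; omega)
  choose SG hSG1 hSG2 hSG3 using fun i => exists_generation_scheme q (by omega) κ i
  -- The evolving scheme costs `2 ℓ g ^ 2`, the generation scheme errs by `2 g + 1 + 10 lg q`, and
  -- `lg |M|` in place of `lg p` by at most `2 g - 1`; the linear terms add up to `4 g`.
  refine ⟨2 * ℓ + 4 + 10 * Real.logb 2 q, fun p hp hpℓ M _ _ _ _ hM1 hM2 => ?_⟩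
  have he (i) : Nonempty ((SG i).Share none ↪ M) :=
    nonempty_embedding_of_card_le (by rw [hSG2, hcard]; omega)
  refine ⟨tripleScheme _, SG, fun i => (he i).some, tripleScheme_isEvolvingThreshold _, hSG1, fun t => ?_⟩
  have h1 := tripleScheme_bits_le (Fin ℓ → Bool) (gen t)
  have h2 := bits_nonneg (tripleScheme (Fin ℓ → Bool)) (gen t)
  have h3 := abs_le.1 (hSG3 (gen t) t rfl)
  have hp0 : (0 : ℝ) < p := by exact_mod_cast hp.pos
  have hM0 : (0 : ℝ) < Nat.card M := by exact_mod_cast Nat.card_pos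
  have h4 : Real.logb 2 p ≤ Real.logb 2 (Nat.card M) :=
    Real.logb_le_logb_of_le (by norm_num) hp0 (by exact_mod_cast hM1)
  have h5 : Real.logb 2 (Nat.card M) ≤ 1 + Real.logb 2 p := by
    calc Real.logb 2 (Nat.card M) ≤ Real.logb 2 (2 * p) :=
        Real.logb_le_logb_of_le (by norm_num) hM0 (by exact_mod_cast hM2.le)
      _ = 1 + Real.logb 2 p := by
        rw [Real.logb_mul (by norm_num) hp0.ne', Real.logb_self_eq_one (by norm_num)]
  rw [hcard] at h1
  push_cast at h1
  rw [Real.logb_pow, Real.logb_self_eq_one (by norm_num), mul_one] at h1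
  rw [revisedScheme_bits]
  have hg : (1 : ℝ) ≤ (gen t : ℕ) := by exact_mod_cast (gen t).pos
  have hmem : (SG (gen t)).bits (some (genMember (gen t) t rfl)) =
    (SG (gen t)).bits (some (genIndex t)) := rfl
  rw [hmem] at h3
  generalize ((gen t : ℕ) : ℝ) = g at *
  have h6 : 0 ≤ (2 * g - 1) * (Real.logb 2 (Nat.card M) - Real.logb 2 p) :=
    mul_nonneg (by linarith) (by linarith)
  have h7 : (2 * g - 1) * (Real.logb 2 (Nat.card M) - Real.logb 2 p) ≤ 2 * g - 1 :=
    mul_le_of_le_one_right (by linarith) (by linarith)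
  have h8 : g ≤ g ^ 2 := by nlinarith
  have h9 : Real.logb 2 q ≤ Real.logb 2 q * g ^ 2 := le_mul_of_one_le_right hL (by nlinarith)
  have h10 : (0 : ℝ) ≤ 2 * ℓ * g ^ 2 := by positivity
  rw [abs_le]
  constructor <;> nlinarith

end DealScheme

theorem mainTheorem1 :
    (∀ t : ℕ+, 3 ≤ t → ((gen t : ℕ) : ℤ) = ⌈Real.logb 4 (Real.logb 2 (t : ℕ))⌉) ∧
    (∀ (S : Type) [Nonempty S] (M : Type) [AddCommGroup M] [Finite M]
      [MeasurableSpace M] [DiscreteMeasurableSpace M]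
      (Sinf : DealScheme S ℕ+) (SG : ∀ i : ℕ+, DealScheme S (Option (Fin (genSize i))))
      (e : ∀ i, (SG i).Share none ↪ M),
      Sinf.IsEvolvingThreshold 3 → (∀ i, (SG i).IsThreshold 3) →
        (revisedScheme Sinf SG e).IsEvolvingThreshold 3 ∧
        ∀ t : ℕ+, (revisedScheme Sinf SG e).bits t =
          Sinf.bits (gen t) + (SG (gen t)).bits (some (genIndex t)) +
            (2 * ((gen t : ℕ) : ℝ) - 1) * Real.logb 2 (Nat.card M)) ∧
    (∀ ℓ : ℕ, 0 < ℓ → ∃ C : ℝ, ∀ p : ℕ, p.Prime → 2 ^ ℓ ≤ p →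
      ∀ (M : Type) [AddCommGroup M] [Finite M] [MeasurableSpace M] [DiscreteMeasurableSpace M],
      p ≤ Nat.card M → Nat.card M < 2 * p →
      ∃ (Sinf : DealScheme (Fin ℓ → Bool) ℕ+)
        (SG : ∀ i : ℕ+, DealScheme (Fin ℓ → Bool) (Option (Fin (genSize i))))
        (e : ∀ i, (SG i).Share none ↪ M),
        Sinf.IsEvolvingThreshold 3 ∧ (∀ i, (SG i).IsThreshold 3) ∧
        (revisedScheme Sinf SG e).IsEvolvingThreshold 3 ∧
        ∀ t : ℕ+, 3 ≤ t →
          |(revisedScheme Sinf SG e).bits t -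
              (Real.logb 2 (t : ℕ) +
                Real.logb 2 p * (2 * (⌈Real.logb 4 (Real.logb 2 (t : ℕ))⌉ : ℝ) - 1))| ≤
            C * (⌈Real.logb 4 (Real.logb 2 (t : ℕ))⌉ : ℝ) ^ 2) := by

  refine ⟨gen_eq_ceil, ?_, fun ℓ _ => ?_⟩
  · intro S _ M _ _ _ _ Sinf SG e hinf hG
    exact ⟨DealScheme.revisedScheme_isEvolvingThreshold Sinf SG e hinf hG,
      DealScheme.revisedScheme_bits Sinf SG e⟩
  · obtain ⟨C, hC⟩ := DealScheme.exists_short_components ℓ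
    refine ⟨C, fun p hp hpℓ M _ _ _ _ hM1 hM2 => ?_⟩
    obtain ⟨Sinf, SG, e, h1, h2, h3⟩ := hC p hp hpℓ M hM1 hM2
    refine ⟨Sinf, SG, e, h1, h2,
      DealScheme.revisedScheme_isEvolvingThreshold Sinf SG e h1 h2, fun t ht => ?_⟩
    have h4 : (⌈Real.logb 4 (Real.logb 2 (t : ℕ))⌉ : ℝ) = ((gen t : ℕ) : ℝ) := by
      rw [← gen_eq_ceil t ht]
      push_cast
      rfl
    rw [h4]
    exact h3 t
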